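/- Let $N\ge 1$, $d\ge 0$, $p\ge 0$ be integers and let $|\cdot|$ denote Euclidean norms. Let $q_1,\dots,q_p:\mathbb R^d\to\mathbb R$, let $G=\{\theta\in\mathbb R^d: q_j(\theta)\le 0,\ j=1,\dots,p\}$, and let $P_G$ be the Euclidean projection onto $G$. Let $f_1,\dots,f_N:\mathbb R^d\to\mathbb R$ and $f=\frac1N\sum_{i=1}^N f_i$. On a probability space $(\Omega,\mathcal A,\mathbb P)$ let $\boldsymbol\theta_0$ and $\boldsymbol Y_n=(Y_{n,1},\dots,Y_{n,N})$, $n\ge1$, be random vectors of $(\mathbb R^d)^N=\mathbb R^{dN}$ and $W_n=[w_n(i,j)]$, $n\ge 1$, random real $N\times N$ matrices. For a real sequence $(\gamma_n)_{n\ge1}$ define $\boldsymbol\theta_n=(\theta_{n,1},\dots,\theta_{n,N})$, $n\ge1$, by $$\tilde\theta_{n,i}=P_G[\theta_{n-1,i}+\gamma_nY_{n,i}],\qquad \theta_{n,i}=\sum_{j=1}^N w_n(i,j)\,\tilde\theta_{n,j}.$$ Let $\mathcal F_n=\sigma(\boldsymbol\theta_0,\boldsymbol Y_1,\dots,\boldsymbol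 Y_n,W_1,\dots,W_n)$, let $(\mu_{\boldsymbol\theta})_{\boldsymbol\theta\in\mathbb R^{dN}}$ be a family of probability measures on $\mathbb R^{dN}$, and let $\rho_n$ be the spectral norm of $\mathbb E\big(W_n^T(I_N-\mathbf 1\mathbf 1^T/N)W_n\big)$. Assume: 1. (Model.) (a) For every $n\ge1$, almost surely $W_n$ has non-negative entries and $W_n\mathbf 1=\mathbf 1$; moreover $\mathbf 1^T\mathbb E(W_n)=\mathbf 1^T$. (b) $n(1-\rho_n)\to+\infty$. (c) For every $n\ge1$: conditionally on $\mathcal F_n$, $W_{n+1}$ and $\boldsymbol Y_{n+1}$ are independent; $W_{n+1}$ is independent of $\mathcal F_n$; and $\mathbb P(\boldsymbol Y_{n+1}\in A\mid\mathcal F_n)=\mu_{\boldsymbol\theta_n}(A)$ a.s. for every Borel set $A$. (d) Each $f_i$ is continuously differentiable. (e) For every $n\ge1$, $\mathbb E[\boldsymbol Y_{n+1}\mid\mathcal F_n]=-(\nabla f_1(\theta_{n,1}),\dots,\nabla f_N(\theta_{n,N}))$ a.s. (f) $\sup_{\boldsymbol\theta\in G^N}\int|\boldsymbol y|^2\,d\mu_{\boldsymbol\theta}(\boldsymbol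 y)<\infty$. 2. (Step sizes.) $\gamma_n>0$ for all $n\ge1$, $\sum_n\gamma_n=\infty$, and there is $\alpha>1/2$ such that $\lim_n n^\alpha\gamma_n=0$ and $\liminf_n \frac{1-\rho_n}{n^\alpha\gamma_n}>0$ (the lower limit may be $+\infty$). 3. (Constraints.) (a) $G$ is nonempty and compact. (b) Each $q_j$ is convex on $\mathbb R^d$ and continuously differentiable in a neighborhood of the boundary $\partial G$. (c) For every $\theta\in\partial G$, the family $(\nabla q_j(\theta): q_j(\theta)=0)$ is linearly independent. Let $\mathcal L=\{\theta\in G:\ -\nabla f(\theta)^T(\theta-\theta')\ge0\ \text{for all }\theta'\in G\}$ be the set of KKT points of $f$ on $G$, and assume that $f(\mathcal L)\subset\mathbb R$ has empty interior. Then, almost surely, the Euclidean distance from $\boldsymbol\theta_n$ to $\{(\theta,\dots,\theta)\in(\mathbb R^d)^N:\theta\in\mathcal L\}$ tends to $0$. Moreover, almost surely there is a (random) connected component $C$ of $\mathcal L$ such that the distance from $\langle\boldsymbol\theta_n\rangle:=\frac1N\sum_{i=1}^N\theta_{n,i}$ to $C$ tends to $0$. -/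

import Mathlib

open MeasureTheory ProbabilityTheory Filter Topology

noncomputable section

namespace DistGossip

/-- `ℝ^d` with the Euclidean norm. -/
abbrev Vec (d : ℕ) : Type := EuclideanSpace ℝ (Fin d)

/-- `ℝ^{dN}`, written as `N` blocks of `ℝ^d`, with the Euclidean norm. -/
abbrev NetVec (N d : ℕ) : Type := PiLp 2 (fun _ : Fin N => Vec d)

/-- The constraint set `G = {θ : q_j(θ) ≤ 0 for all j}`. -/
def feasibleSet {d p : ℕ} (q : Fin p → Vec d → ℝ) : Set (Vec d) :=
  {θ | ∀ j, q j θ ≤ 0}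

/-- The active set `A(θ) = {j : q_j(θ) = 0, θ ∈ G}`. -/
def activeSet {d p : ℕ} (q : Fin p → Vec d → ℝ) (θ : Vec d) : Set (Fin p) :=
  {j | q j θ = 0 ∧ θ ∈ feasibleSet q}

/-- The product set `G^N`. -/
def prodSet (N : ℕ) {d : ℕ} (G : Set (Vec d)) : Set (NetVec N d) :=
  {x | ∀ i, x i ∈ G}

/-- The Euclidean projection `P_G[x]`: a point of `G` nearest to `x`. It exists and is unique
when `G` is nonempty, closed and convex. -/
def proj {d : ℕ} (G : Set (Vec d)) (x : Vec d) : Vec d :=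
  Classical.epsilon fun y => y ∈ G ∧ ∀ z ∈ G, dist x y ≤ dist x z

/-- One iteration: the local step `θ̃_i = P_G[θ_i + γ y_i]` followed by the gossip step
`θ_i' = ∑_j w(i,j) θ̃_j`. -/
def step {N d : ℕ} (G : Set (Vec d)) (γ : ℝ) (w : Matrix (Fin N) (Fin N) ℝ)
    (y θ : NetVec N d) : NetVec N d :=
  WithLp.toLp 2 fun i => ∑ j, w i j • proj G (θ j + γ • y j)

/-- The iterates `θ_0, θ_1, θ_2, …`; only `γ n`, `W n`, `Y n` with `n ≥ 1` are used. -/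
def iterate {Ω : Type*} {N d : ℕ} (G : Set (Vec d)) (γ : ℕ → ℝ)
    (W : ℕ → Ω → Matrix (Fin N) (Fin N) ℝ) (Y : ℕ → Ω → NetVec N d)
    (θ₀ : Ω → NetVec N d) : ℕ → Ω → NetVec N d
  | 0 => θ₀
  | n + 1 => fun ω =>
      step G (γ (n + 1)) (W (n + 1) ω) (Y (n + 1) ω) (iterate G γ W Y θ₀ n ω)

/-- The product (Borel) σ-field on square real matrices. -/
instance matrixMeasurableSpace (N : ℕ) : MeasurableSpace (Matrix (Fin N) (Fin N) ℝ) :=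
  inferInstanceAs (MeasurableSpace (Fin N → Fin N → ℝ))

/-- The σ-field `F_n = σ(θ_0, Y_1, …, Y_n, W_1, …, W_n)`. -/
abbrev pastField {Ω : Type*} {N d : ℕ} (W : ℕ → Ω → Matrix (Fin N) (Fin N) ℝ)
    (Y : ℕ → Ω → NetVec N d) (θ₀ : Ω → NetVec N d) (n : ℕ) : MeasurableSpace Ω :=
  MeasurableSpace.comap θ₀ inferInstance ⊔
    ⨆ k ∈ Finset.Icc 1 n,
      (MeasurableSpace.comap (Y k) inferInstance ⊔ MeasurableSpace.comap (W k) inferInstance)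

/-- Entrywise expectation of a random matrix. -/
def expMatrix {Ω : Type*} [MeasurableSpace Ω] {N : ℕ} (P : Measure Ω)
    (M : Ω → Matrix (Fin N) (Fin N) ℝ) : Matrix (Fin N) (Fin N) ℝ :=
  Matrix.of fun i j => ∫ ω, M ω i j ∂P

/-- The matrix `I_N - 1 1ᵀ / N`. -/
def disagreement (N : ℕ) : Matrix (Fin N) (Fin N) ℝ :=
  1 - Matrix.of fun _ _ => (1 : ℝ) / N

/-- The spectral norm (operator norm for the Euclidean norm) of a square matrix. -/
def matrixSpectralNorm {N : ℕ} (M : Matrix (Fin N) (Fin N) ℝ) : ℝ :=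
  ‖Matrix.toEuclideanCLM (n := Fin N) (𝕜 := ℝ) M‖

/-- `ρ = ‖E(Wᵀ (I_N - 1 1ᵀ / N) W)‖` for a random matrix `W`. -/
def rho {Ω : Type*} [MeasurableSpace Ω] {N : ℕ} (P : Measure Ω)
    (W : Ω → Matrix (Fin N) (Fin N) ℝ) : ℝ :=
  matrixSpectralNorm (expMatrix P fun ω => (W ω).transpose * disagreement N * W ω)

/-- `X` and `Z` are conditionally independent given the sub-σ-field `m`. -/
def CondIndepGiven {Ω E F : Type*} [MeasurableSpace Ω] [MeasurableSpace E] [MeasurableSpace F]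
    (P : Measure Ω) (m : MeasurableSpace Ω) (X : Ω → E) (Z : Ω → F) : Prop :=
  ∀ (A : Set E) (B : Set F), MeasurableSet A → MeasurableSet B →
    P⟦X ⁻¹' A ∩ Z ⁻¹' B | m⟧ =ᵐ[P] fun ω => (P⟦X ⁻¹' A | m⟧) ω * (P⟦Z ⁻¹' B | m⟧) ω

/-- Assumption on the observations and on the network. -/
structure ModelAssumption {Ω : Type*} [MeasurableSpace Ω] {N d : ℕ} (P : Measure Ω)
    (G : Set (Vec d)) (f : Fin N → Vec d → ℝ) (γ : ℕ → ℝ)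
    (W : ℕ → Ω → Matrix (Fin N) (Fin N) ℝ) (Y : ℕ → Ω → NetVec N d)
    (θ₀ : Ω → NetVec N d) (μ : NetVec N d → Measure (NetVec N d)) : Prop where
  measurable_init : Measurable θ₀
  measurable_Y : ∀ n, 1 ≤ n → Measurable (Y n)
  measurable_W : ∀ n, 1 ≤ n → Measurable (W n)
  /-- non-negative entries -/
  nonneg : ∀ n, 1 ≤ n → ∀ᵐ ω ∂P, ∀ i j, 0 ≤ W n ω i j
  /-- `W_n 1 = 1` -/
  row_stochastic : ∀ n, 1 ≤ n → ∀ᵐ ω ∂P, ∀ i, ∑ j, W n ω i j = 1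
  /-- `1ᵀ E(W_n) = 1ᵀ` -/
  col_stochastic_mean : ∀ n, 1 ≤ n → ∀ j, ∑ i, expMatrix P (W n) i j = 1
  /-- `n (1 - ρ_n) → +∞` -/
  connectivity : Tendsto (fun n : ℕ => (n : ℝ) * (1 - rho P (W n))) atTop atTop
  /-- `W_{n+1}` and `Y_{n+1}` are independent conditionally on the past -/
  cond_indep : ∀ n, 1 ≤ n →
    CondIndepGiven P (pastField W Y θ₀ n) (W (n + 1)) (Y (n + 1))
  /-- `W_{n+1}` is independent of the past (so that the matrices form an independent sequence) -/
  indep_past : ∀ n, 1 ≤ n →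
    Indep (MeasurableSpace.comap (W (n + 1)) inferInstance) (pastField W Y θ₀ n) P
  prob_law : ∀ x, IsProbabilityMeasure (μ x)
  /-- the law of `Y_{n+1}` conditionally on the past is `μ_{θ_n}` -/
  cond_law : ∀ n, 1 ≤ n → ∀ A : Set (NetVec N d), MeasurableSet A →
    P⟦Y (n + 1) ⁻¹' A | pastField W Y θ₀ n⟧ =ᵐ[P]
      fun ω => (μ (iterate G γ W Y θ₀ n ω)).real A
  contDiff : ∀ i, ContDiff ℝ 1 (f i)
  /-- `E[Y_{n+1} | F_n] = -(∇f_1(θ_{n,1}), …, ∇f_N(θ_{n,N}))` -/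
  cond_mean : ∀ n, 1 ≤ n →
    P[Y (n + 1) | pastField W Y θ₀ n] =ᵐ[P]
      fun ω => WithLp.toLp 2 fun i => -gradient (f i) (iterate G γ W Y θ₀ n ω i)
  /-- `sup_{θ ∈ G^N} ∫ |y|² dμ_θ(y) < ∞` -/
  second_moment : (⨆ x ∈ prodSet N G, ∫⁻ y, ‖y‖ₑ ^ 2 ∂(μ x)) < ⊤

/-- Assumption on the step sizes. The lower limit is taken in the extended reals. -/
structure StepAssumption (γ ρ : ℕ → ℝ) : Prop where
  pos : ∀ n, 1 ≤ n → 0 < γ n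
  sum_infinite : Tendsto (fun n => ∑ k ∈ Finset.Icc 1 n, γ k) atTop atTop
  rate : ∃ α : ℝ, 1 / 2 < α ∧
    Tendsto (fun n : ℕ => (n : ℝ) ^ α * γ n) atTop (𝓝 0) ∧
    0 < liminf (fun n : ℕ => (((1 - ρ n) / ((n : ℝ) ^ α * γ n) : ℝ) : EReal)) atTop

/-- Assumption on the constraints. -/
structure ConstraintAssumption {d p : ℕ} (q : Fin p → Vec d → ℝ) : Prop where
  nonempty : (feasibleSet q).Nonempty
  compact : IsCompact (feasibleSet q)
  convex : ∀ j, ConvexOn ℝ Set.univ (q j)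
  smooth : ∀ j, ∃ U : Set (Vec d), IsOpen U ∧ frontier (feasibleSet q) ⊆ U ∧
    ContDiffOn ℝ 1 (q j) U
  qualified : ∀ θ ∈ frontier (feasibleSet q),
    LinearIndependent ℝ (fun j : activeSet q θ => gradient (q j) θ)

/-- The average utility `f = (1/N) ∑ f_i`. -/
def avgUtility {N d : ℕ} (f : Fin N → Vec d → ℝ) (θ : Vec d) : ℝ :=
  (1 / (N : ℝ)) * ∑ i, f i θ

/-- The normal cone `{v : vᵀ(θ - θ') ≥ 0 for all θ' ∈ G}`. -/
def normalCone {d : ℕ} (G : Set (Vec d)) (θ : Vec d) : Set (Vec d) :=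
  {v | ∀ θ' ∈ G, 0 ≤ inner ℝ v (θ - θ')}

/-- The set of KKT points of `F` on `G`. -/
def kktSet {d : ℕ} (G : Set (Vec d)) (F : Vec d → ℝ) : Set (Vec d) :=
  {θ | θ ∈ G ∧ -gradient F θ ∈ normalCone G θ}

/-- `1 ⊗ θ`. -/
def consensus (N : ℕ) {d : ℕ} (θ : Vec d) : NetVec N d :=
  WithLp.toLp 2 fun _ => θ

/-- The network average `⟨x⟩ = (x_1 + ⋯ + x_N) / N`. -/
def netAvg {N d : ℕ} (x : NetVec N d) : Vec d :=
  (1 / (N : ℝ)) • ∑ i, x i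

/-- `x_n` converges to the set `A`: `d(x_n, A) → 0` (with `d(x, ∅) = ∞`). -/
def ConvergesToSet {E : Type*} [PseudoEMetricSpace E] (x : ℕ → E) (A : Set E) : Prop :=
  Tendsto (fun n => Metric.infEDist (x n) A) atTop (𝓝 0)

end DistGossip

end

/-! The network averages form a noisy discretization of the projected gradient dynamics `x' ∈ -∇f(x)
- N_G(x)`, with `f` as Lyapunov function.

Consensus. `W_{n+1}` is independent of everything that precedes the gossip step, so gossip
multiplies the mean square disagreement by at most `ρ_{n+1}`, while the local step adds an error
governed by `γ²`. Since `n (1 - ρ_n) → ∞` and `1 - ρ_n` is at least of order `n^α γ_n`, the mean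
square disagreement is `O(n^(-2α))`, hence summable (`summable_of_contraction`), and the
disagreement vanishes almost surely.

Noise. Column sums of `W` have mean one, so the unpredicted part of the increments of the average is
a martingale difference. Its variance is controlled by the disagreement and by `γ²`, both summable,
so the noise series converges. Adding the tail of that series to the average gives a sequence `z`
with `z_{n+1} = z_n + γ h_n`, where `h_n` is a conditional mean direction.

Lyapunov argument. The projection is used through one consequence of its obtuse angle property:
`⟨∇f(z) + h, z - y⟩ ≤ o(1)` for every `y ∈ G` (`meanDirection_variational` and
`pathwise_convergence`). This cannot be tested in the direction `h` itself. It can be tested near an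
exponential moving average `a` of `z` over a time scale `S`, because `a` stays close to the convex
set `G`. With `v = (z - a)/S`, the quantity `f(a) + (S/2)|v|²` has rate of change `⟨∇f(a) + h, v⟩ -
|v|²`, at most `-|v|²` plus a small error (`energy_inequality`). Thus `f(z)` hardly increases, and
it loses a definite amount whenever `z` travels a definite distance in bounded time. Near a
noncritical point it must travel, because some `y ∈ G` attracts it at a positive rate
(`exists_decrease`).

If a limit point were noncritical, `f(z)` would pass upwards infinitely often through a gap just
below its value. As `f(L)` has empty interior, some level in the gap is not critical, and
upcrossings from that level are impossible (`not_upcrossing`). So all limit points are critical.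
Steps vanish, hence the limit set is connected and lies in one component of `L`. -/

noncomputable section

namespace DistGossip

/-! ### Lyapunov analysis of the perturbed projected gradient flow. -/

section Deterministic

variable {E : Type*} [NormedAddCommGroup E] [InnerProductSpace ℝ E]

/-- A bounded sequence `z` driven by steps `γ n • h n` that asymptotically follows the projected
gradient dynamics `z' ∈ -g(z) - N_G(z)` on the convex compact set `G`. -/
structure AsympProjectedFlow (G : Set E) (g : E → E) (γ : ℕ → ℝ) (z h : ℕ → E) (M R : ℝ) :
    Prop where
  compact : IsCompact G
  convex : Convex ℝ G
  nonempty : G.Nonempty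
  pos : ∀ n, 0 < γ n
  tendsto_zero : Tendsto γ atTop (𝓝 0)
  sum_infinite : Tendsto (fun n => ∑ k ∈ Finset.range n, γ k) atTop atTop
  step : ∀ n, z (n + 1) = z n + γ n • h n
  M_pos : 0 < M
  bound : ∀ n, ‖h n‖ ≤ M
  mem_ball : ∀ n, z n ∈ Metric.closedBall (0 : E) R
  near : ∀ δ > 0, ∀ᶠ n in atTop, z n ∈ Metric.cthickening δ G
  variational : ∀ ε > 0, ∀ᶠ n in atTop, ∀ y ∈ G, inner ℝ (g (z n) + h n) (z n - y) ≤ ε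

/-- The points `x` of `G` at which `-g x` is normal to `G`. -/
def criticalSet (G : Set E) (g : E → E) : Set E :=
  {x | x ∈ G ∧ ∀ y ∈ G, 0 ≤ inner ℝ (-g x) (x - y)}

/-- Mean value inequality for `F` minus its linearization at `x`: the gradient of the difference is
bounded by `ε` on the segment. -/
lemma sub_le_inner_add_of_modulus [CompleteSpace E] {F : E → ℝ} {g : E → E}
    (hF : ∀ x, HasGradientAt F (g x) x) {K : Set E} (hK : Convex ℝ K) {η ε : ℝ}
    (hω : ∀ x ∈ K, ∀ y ∈ K, ‖x - y‖ ≤ η → ‖g x - g y‖ ≤ ε) {x y : E} (hx : x ∈ K) (hy : y ∈ K)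
    (hxy : ‖y - x‖ ≤ η) : F y - F x ≤ inner ℝ (g x) (y - x) + ε * ‖y - x‖ := by
  have hseg : segment ℝ x y ⊆ K := hK.segment_subset hx hy
  have key := (convex_segment x y).norm_image_sub_le_of_norm_hasFDerivWithin_le'
    (f := F) (f' := fun u => InnerProductSpace.toDual ℝ E (g u))
    (φ := InnerProductSpace.toDual ℝ E (g x)) (C := ε)
    (fun u _ => (hF u).hasFDerivAt.hasFDerivWithinAt)
    (fun u hu => by
      rw [← map_sub, LinearIsometryEquiv.norm_map]
      refine hω u (hseg hu) x hx ?_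
      have := norm_sub_le_of_mem_segment hu
      exact this.trans hxy)
    (left_mem_segment ℝ x y) (right_mem_segment ℝ x y)
  have h2 := (abs_le.mp (by simpa only [Real.norm_eq_abs] using key)).2
  simp only [InnerProductSpace.toDual_apply_apply] at h2
  linarith

lemma exists_modulus {E : Type*} [NormedAddCommGroup E] [ProperSpace E] {g : E → E}
    (hg : Continuous g) (R : ℝ) {ε : ℝ} (hε : 0 < ε) :
    ∃ η > 0, ∀ x ∈ Metric.closedBall (0 : E) R, ∀ y ∈ Metric.closedBall (0 : E) R,
      ‖x - y‖ ≤ η → ‖g x - g y‖ ≤ ε := by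
  have huc := (isCompact_closedBall (0 : E) R).uniformContinuousOn_of_continuous hg.continuousOn
  rw [Metric.uniformContinuousOn_iff] at huc
  obtain ⟨δ, hδ, H⟩ := huc ε hε
  refine ⟨δ / 2, by positivity, fun x hx y hy hxy => ?_⟩
  have := H x hx y hy (by rw [dist_eq_norm]; linarith)
  rw [dist_eq_norm] at this
  exact this.le

lemma exists_norm_bound {E : Type*} [NormedAddCommGroup E] [ProperSpace E] {g : E → E}
    (hg : Continuous g) (R : ℝ) :
    ∃ B > 0, ∀ x ∈ Metric.closedBall (0 : E) R, ‖g x‖ ≤ B := by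
  obtain ⟨B, hB⟩ := (isCompact_closedBall (0 : E) R).exists_bound_of_continuousOn hg.continuousOn
  exact ⟨max B 1, by positivity, fun x hx => (hB x hx).trans (le_max_left _ _)⟩

lemma abs_sub_le_of_gradient_bound [CompleteSpace E] {F : E → ℝ} {g : E → E}
    (hF : ∀ x, HasGradientAt F (g x) x) {K : Set E} (hK : Convex ℝ K) {B : ℝ}
    (hB : ∀ x ∈ K, ‖g x‖ ≤ B) {x y : E} (hx : x ∈ K) (hy : y ∈ K) :
    |F y - F x| ≤ B * ‖y - x‖ := by
  have := hK.norm_image_sub_le_of_norm_hasFDerivWithin_le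
    (f := F) (f' := fun u => InnerProductSpace.toDual ℝ E (g u)) (C := B)
    (fun u _ => (hF u).hasFDerivAt.hasFDerivWithinAt)
    (fun u hu => by rw [LinearIsometryEquiv.norm_map]; exact hB u hu) hx hy
  simpa only [Real.norm_eq_abs] using this

/-- The moving average of `z` over a time scale `S`, started at time `n`. -/
def movingAverage (γ : ℕ → ℝ) (z : ℕ → E) (S : ℝ) (n : ℕ) : ℕ → E
  | 0 => z n
  | k + 1 => movingAverage γ z S n k +
      (γ (n + k) / S) • (z (n + k) - movingAverage γ z S n k)

variable {G : Set E} {F : E → ℝ} {g : E → E} {γ : ℕ → ℝ} {z h : ℕ → E} {M R : ℝ}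

lemma movingAverage_mem {K : Set E} (hK : Convex ℝ K) {S : ℝ} (hS : 0 < S)
    {n : ℕ} (hz : ∀ m ≥ n, z m ∈ K) (hγ : ∀ m ≥ n, 0 < γ m ∧ γ m ≤ S) (k : ℕ) :
    movingAverage γ z S n k ∈ K := by
  induction k with
  | zero => exact hz n le_rfl
  | succ k ih =>
    have h1 := hγ (n + k) (by omega)
    have : movingAverage γ z S n (k + 1) =
        (1 - γ (n + k) / S) • movingAverage γ z S n k + (γ (n + k) / S) • z (n + k) := by
      simp only [movingAverage]; module
    rw [this]
    refine hK ih (hz _ (by omega)) ?_ (div_nonneg h1.1.le hS.le) (by ring)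
    rw [sub_nonneg, div_le_one hS]
    exact h1.2

/-- At each step the gap is multiplied by `1 - γ/S` and receives at most `γ M`; `S * M` is the fixed
point of this recursion. -/
lemma norm_sub_movingAverage_le (hstep : ∀ n, z (n + 1) = z n + γ n • h n)
    (hM : ∀ n, ‖h n‖ ≤ M) {S : ℝ} (hS : 0 < S) {n : ℕ}
    (hγ : ∀ m ≥ n, 0 < γ m ∧ γ m ≤ S) (k : ℕ) :
    ‖z (n + k) - movingAverage γ z S n k‖ ≤ S * M := by
  have hM0 : 0 ≤ M := (norm_nonneg _).trans (hM 0)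
  induction k with
  | zero => simp only [movingAverage, add_zero, sub_self, norm_zero]; positivity
  | succ k ih =>
    have h1 := hγ (n + k) (by omega)
    have e : z (n + (k + 1)) - movingAverage γ z S n (k + 1) =
        (1 - γ (n + k) / S) • (z (n + k) - movingAverage γ z S n k) + γ (n + k) • h (n + k) := by
      rw [← add_assoc, hstep]; simp only [movingAverage]; module
    have h2 : 0 ≤ 1 - γ (n + k) / S := by rw [sub_nonneg, div_le_one hS]; exact h1.2
    calc _ ≤ (1 - γ (n + k) / S) * (S * M) + γ (n + k) * M := by
          rw [e]
          refine (norm_add_le _ _).trans ?_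
          rw [norm_smul, norm_smul, Real.norm_of_nonneg h2, Real.norm_of_nonneg h1.1.le]
          gcongr
          · exact h1.1.le
          · exact hM _
      _ = S * M := by field_simp; ring

/-- Over any window starting late enough, `F` of the moving average decreases at least by the
integral of the squared velocity, up to an error proportional to the length of the window. -/
lemma AsympProjectedFlow.energy_inequality [ProperSpace E]
    (H : AsympProjectedFlow G g γ z h M R)
    (hF : ∀ x, HasGradientAt F (g x) x) (hg : Continuous g) {S ε : ℝ} (hS : 0 < S) (hε : 0 < ε)
    (hω : ∀ x ∈ Metric.closedBall (0 : E) R, ∀ y ∈ Metric.closedBall (0 : E) R,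
      ‖x - y‖ ≤ S * M → ‖g x - g y‖ ≤ ε) :
    ∀ᶠ n in atTop, (∀ m ≥ n, 0 < γ m ∧ γ m ≤ S) ∧ ∀ k,
      F (movingAverage γ z S n k) ≤ F (z n) + ∑ j ∈ Finset.range k, γ (n + j) *
        ((2 * M + 1) * ε - ‖(1 / S) • (z (n + j) - movingAverage γ z S n j)‖ ^ 2) := by
  obtain ⟨B, hB0, hB⟩ := exists_norm_bound hg R
  have hM := H.M_pos
  -- Replacing `a k` by a point of `G` at distance at most `δ` changes an inner product with `g + h`
  -- by at most `(B + M) * δ = ε * S / 3`.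
  set δ : ℝ := ε * S / (3 * (B + M)) with hδ
  have hδ0 : 0 < δ := by positivity
  have ev : ∀ᶠ n in atTop, γ n ≤ S ∧ 2 * γ n * M ^ 2 / S ≤ ε / 3 ∧
      z n ∈ Metric.cthickening (δ / 2) G ∧
      ∀ y ∈ G, inner ℝ (g (z n) + h n) (z n - y) ≤ ε * S / 3 := by
    have e1 : ∀ᶠ n in atTop, γ n < S := H.tendsto_zero.eventually_lt_const hS
    have e2 : ∀ᶠ n in atTop, γ n < ε * S / (6 * M ^ 2) :=
      H.tendsto_zero.eventually_lt_const (by positivity)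
    filter_upwards [e1, e2, H.near (δ / 2) (by positivity),
      H.variational (ε * S / 3) (by positivity)]
      with n h1 h2 h3 h4
    refine ⟨h1.le, ?_, h3, h4⟩
    rw [lt_div_iff₀ (by positivity)] at h2
    rw [div_le_iff₀ hS]
    nlinarith
  filter_upwards [eventually_forall_ge_atTop.mpr ev] with n hn
  have hγ : ∀ m ≥ n, 0 < γ m ∧ γ m ≤ S := fun m hm => ⟨H.pos m, (hn m hm).1⟩
  refine ⟨hγ, ?_⟩
  set a := movingAverage γ z S n with ha
  set v : ℕ → E := fun j => (1 / S) • (z (n + j) - a j) with hv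
  -- The kinetic term turns `⟨g, v⟩` into `⟨g + h, v⟩ - ‖v‖²`, since `v` moves by `(γ/S)(h - v)`. It
  -- costs nothing at the ends: it is zero at `k = 0`, where the average starts at `z n`, and
  -- nonnegative afterwards. The error `(2M + 1)ε` is the sum of `εM` (linearizing `F`), `εM`
  -- (moving `g` from `a` to `z`), `2ε/3` (variational inequality) and `ε/3` (second order term in
  -- `v`).
  suffices hmain : ∀ k, F (a k) + S / 2 * ‖v k‖ ^ 2 ≤ F (z n) +
      ∑ j ∈ Finset.range k, γ (n + j) * ((2 * M + 1) * ε - ‖v j‖ ^ 2) by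
    intro k
    have := hmain k
    have : 0 ≤ S / 2 * ‖v k‖ ^ 2 := by positivity
    linarith
  have haK : ∀ k, a k ∈ Metric.closedBall (0 : E) R := fun k =>
    movingAverage_mem (convex_closedBall _ _) hS (fun m _ => H.mem_ball m) hγ k
  have haG : ∀ k, a k ∈ Metric.cthickening (δ / 2) G := fun k =>
    movingAverage_mem (H.convex.cthickening _) hS (fun m hm => (hn m hm).2.2.1) hγ k
  have hclose : ∀ k, ‖z (n + k) - a k‖ ≤ S * M := fun k =>
    norm_sub_movingAverage_le H.step H.bound hS hγ k
  have hvM : ∀ k, ‖v k‖ ≤ M := fun k => by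
    rw [hv]; simp only; rw [norm_smul, Real.norm_of_nonneg (by positivity), one_div_mul_eq_div,
      div_le_iff₀ hS, mul_comm]; exact hclose k
  have hSv : ∀ k, z (n + k) - a k = S • v k := fun k => by
    simp only [hv, smul_smul]; rw [mul_one_div_cancel hS.ne', one_smul]
  have hastep : ∀ k, a (k + 1) = a k + γ (n + k) • v k := fun k => by
    rw [ha]; simp only [movingAverage, hv, smul_smul]; rw [mul_one_div]
  have ha0 : a 0 = z n := rfl
  have hv0 : v 0 = 0 := by simp [hv, ha0]
  clear_value v a
  intro k
  induction k with
  | zero => simp [hv0, ha0]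
  | succ k ih =>
    rw [Finset.sum_range_succ]
    obtain ⟨hγS, hγε, -, hvar⟩ := hn (n + k) (by omega)
    have hγ0 := H.pos (n + k)
    set c := γ (n + k)
    have e1 : F (a (k + 1)) - F (a k) ≤ c * inner ℝ (g (a k)) (v k) + c * (ε * M) := by
      have hd : a (k + 1) - a k = c • v k := by rw [hastep]; abel
      have hdn : ‖a (k + 1) - a k‖ = c * ‖v k‖ := by
        rw [hd, norm_smul, Real.norm_of_nonneg hγ0.le]
      have := sub_le_inner_add_of_modulus hF (convex_closedBall (0 : E) R) hω (haK k) (haK (k + 1))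
        (by rw [hdn]; exact mul_le_mul hγS (hvM k) (norm_nonneg _) hS.le)
      rw [hdn, hd, inner_smul_right] at this
      have : ε * (c * ‖v k‖) ≤ c * (ε * M) := by
        have := mul_le_mul_of_nonneg_left (hvM k) (by positivity : 0 ≤ ε * c)
        linarith
      linarith
    have e2 : S / 2 * ‖v (k + 1)‖ ^ 2 ≤ S / 2 * ‖v k‖ ^ 2 + c * inner ℝ (v k) (h (n + k))
        - c * ‖v k‖ ^ 2 + c * (ε / 3) := by
      have hv1 : v (k + 1) = v k + (c / S) • (h (n + k) - v k) := by
        have : S • v (k + 1) = S • (v k + (c / S) • (h (n + k) - v k)) := by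
          have h1 := hSv k
          rw [← hSv, ← add_assoc, H.step, hastep, smul_add, ← h1, smul_smul,
            mul_div_cancel₀ _ hS.ne']
          module
        exact smul_right_injective E hS.ne' this
      have hn2 : ‖h (n + k) - v k‖ ^ 2 ≤ 4 * M ^ 2 := by
        have := (norm_sub_le (h (n + k)) (v k)).trans (add_le_add (H.bound _) (hvM k))
        have h0 := norm_nonneg (h (n + k) - v k)
        nlinarith
      rw [hv1, norm_add_sq_real, inner_smul_right, inner_sub_right, real_inner_self_eq_norm_sq,
        norm_smul, Real.norm_of_nonneg (by positivity : 0 ≤ c / S), mul_pow]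
      have e3 : S / 2 * ((c / S) ^ 2 * ‖h (n + k) - v k‖ ^ 2) ≤ c * (ε / 3) := by
        calc _ ≤ S / 2 * ((c / S) ^ 2 * (4 * M ^ 2)) := by gcongr
          _ = c * (2 * c * M ^ 2 / S) := by field_simp; ring
          _ ≤ _ := by gcongr
      have e4 : S / 2 * (2 * (c / S * (inner ℝ (v k) (h (n + k)) - ‖v k‖ ^ 2))) =
          c * inner ℝ (v k) (h (n + k)) - c * ‖v k‖ ^ 2 := by field_simp
      linarith
    have e3 : inner ℝ (g (a k)) (v k) ≤ inner ℝ (g (z (n + k))) (v k) + ε * M := by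
      have h1 : inner ℝ (g (a k) - g (z (n + k))) (v k) ≤ ε * M :=
        (real_inner_le_norm _ _).trans (mul_le_mul
          (hω _ (haK k) _ (H.mem_ball _) (by rw [norm_sub_rev]; exact hclose k)) (hvM k)
          (norm_nonneg _) hε.le)
      rw [inner_sub_left] at h1
      linarith
    -- The variational inequality is applied at a point of `G` close to `a k`, then divided by `S`;
    -- this is why its tolerance was taken proportional to `S`.
    have e4 : inner ℝ (g (z (n + k))) (v k) + inner ℝ (v k) (h (n + k)) ≤ 2 * ε / 3 := by
      obtain ⟨y, hyG, hy⟩ : ∃ y ∈ G, dist (a k) y < δ := by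
        have h1 : Metric.infDist (a k) G < δ :=
          lt_of_le_of_lt (ENNReal.toReal_le_of_le_ofReal (by positivity)
            (Metric.mem_cthickening_iff.mp (haG k))) (by linarith)
        exact (Metric.infDist_lt_iff H.nonempty).mp h1
      have h1 := hvar y hyG
      have h2 : inner ℝ (g (z (n + k)) + h (n + k)) (y - a k) ≤ ε * S / 3 := by
        refine (real_inner_le_norm _ _).trans ?_
        have h3 : ‖g (z (n + k)) + h (n + k)‖ ≤ B + M :=
          (norm_add_le _ _).trans (add_le_add (hB _ (H.mem_ball _)) (H.bound _))
        have h4 : ‖y - a k‖ ≤ δ := by rw [← dist_eq_norm, dist_comm]; exact hy.le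
        calc _ ≤ (B + M) * δ := mul_le_mul h3 h4 (norm_nonneg _) (by positivity)
          _ = ε * S / 3 := by rw [hδ]; field_simp
      have h3 : inner ℝ (g (z (n + k)) + h (n + k)) (z (n + k) - a k) ≤ 2 * (ε * S) / 3 := by
        have : z (n + k) - a k = (z (n + k) - y) + (y - a k) := by abel
        rw [this, inner_add_right]; linarith
      rw [hSv, inner_smul_right, inner_add_left] at h3
      rw [real_inner_comm (h (n + k)) (v k)]
      rw [le_div_iff₀ (by norm_num)] at h3 ⊢
      nlinarith
    have e5 : c * inner ℝ (g (a k)) (v k) + c * inner ℝ (v k) (h (n + k)) ≤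
        c * (2 * ε / 3 + ε * M) := by
      rw [← mul_add]; exact mul_le_mul_of_nonneg_left (by linarith) hγ0.le
    have e6 : c * ((2 * M + 1) * ε - ‖v k‖ ^ 2) = c * (2 * ε / 3 + ε * M) + c * (ε * M)
      + c * (ε / 3) - c * ‖v k‖ ^ 2 := by ring
    linarith

/-- For every small enough time scale `S` of the moving average, the energy inequality turns into
a bound on `F (z (n + k)) - F (z n)`. -/
lemma AsympProjectedFlow.exists_scale [ProperSpace E]
    (H : AsympProjectedFlow G g γ z h M R)
    (hF : ∀ x, HasGradientAt F (g x) x) (hg : Continuous g) {T ε r : ℝ} (hT : 0 < T) (hε : 0 < ε)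
    (hr : 0 < r) :
    ∃ S > 0, S * M ≤ r ∧ ∀ᶠ n in atTop, (∀ m ≥ n, 0 < γ m ∧ γ m ≤ S) ∧ ∀ k,
      ∑ j ∈ Finset.range k, γ (n + j) ≤ T →
      F (z (n + k)) ≤ F (z n) + ε - ∑ j ∈ Finset.range k, γ (n + j) *
        ‖(1 / S) • (z (n + j) - movingAverage γ z S n j)‖ ^ 2 := by
  obtain ⟨B, hB0, hB⟩ := exists_norm_bound hg R
  have hM := H.M_pos
  -- Over a window of length at most `T` the accumulated error is then at most `ε / 2`.
  set ε' := ε / 2 / (T * (2 * M + 1)) with hε'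
  have hε'0 : 0 < ε' := by positivity
  obtain ⟨η, hη, hω⟩ := exists_modulus hg R hε'0
  -- The three bounds put `z` and its average within the modulus of `g`, within `r` of each other,
  -- and make their `F`-values differ by at most `ε / 2`.
  set S := min (min (η / M) (r / M)) (ε / (2 * B * M)) with hSdef
  have hS : 0 < S := by positivity
  have h1 : S * M ≤ η := by
    rw [← le_div_iff₀ hM]; exact (min_le_left _ _).trans (min_le_left _ _)
  have h2 : S * M ≤ r := by
    rw [← le_div_iff₀ hM]; exact (min_le_left _ _).trans (min_le_right _ _)
  have h3 : B * (S * M) ≤ ε / 2 := by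
    have : S ≤ ε / (2 * B * M) := min_le_right _ _
    rw [le_div_iff₀ (by positivity)] at this
    linarith
  refine ⟨S, hS, h2, ?_⟩
  filter_upwards [H.energy_inequality hF hg hS hε'0
    (fun x hx y hy hxy => hω x hx y hy (hxy.trans h1))] with n hn
  refine ⟨hn.1, fun k hk => ?_⟩
  have h4 := hn.2 k
  have h5 : |F (z (n + k)) - F (movingAverage γ z S n k)| ≤ B * (S * M) :=
    (abs_sub_le_of_gradient_bound hF (convex_closedBall (0 : E) R) hB
      (movingAverage_mem (convex_closedBall _ _) hS (fun m _ => H.mem_ball m) hn.1 k)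
      (H.mem_ball _)).trans (mul_le_mul_of_nonneg_left
        (norm_sub_movingAverage_le H.step H.bound hS hn.1 k) hB0.le)
  have h6 := (abs_le.mp h5).2
  simp only [mul_sub, Finset.sum_sub_distrib, ← Finset.sum_mul] at h4
  have h7 : (∑ j ∈ Finset.range k, γ (n + j)) * ((2 * M + 1) * ε') ≤ ε / 2 := by
    calc _ ≤ T * ((2 * M + 1) * ε') := by gcongr
      _ = ε / 2 := by rw [hε']; field_simp
  linarith

/-- Along the flow, `F` hardly increases over windows of bounded length. -/
lemma AsympProjectedFlow.almost_decreasing [ProperSpace E]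
    (H : AsympProjectedFlow G g γ z h M R)
    (hF : ∀ x, HasGradientAt F (g x) x) (hg : Continuous g) {T ε : ℝ} (hT : 0 < T) (hε : 0 < ε) :
    ∀ᶠ n in atTop, ∀ k, ∑ j ∈ Finset.range k, γ (n + j) ≤ T → F (z (n + k)) ≤ F (z n) + ε := by
  obtain ⟨S, -, -, hev⟩ := H.exists_scale hF hg hT hε one_pos
  filter_upwards [hev] with n hn k hk
  have h1 := hn.2 k hk
  have : 0 ≤ ∑ j ∈ Finset.range k, γ (n + j) *
        ‖(1 / S) • (z (n + j) - movingAverage γ z S n j)‖ ^ 2 :=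
    Finset.sum_nonneg fun j _ => mul_nonneg (H.pos _).le (by positivity)
  linarith

/-- Near a noncritical point, `F` decreases by a definite amount in bounded time. -/
lemma AsympProjectedFlow.exists_decrease [ProperSpace E]
    (H : AsympProjectedFlow G g γ z h M R)
    (hF : ∀ x, HasGradientAt F (g x) x) (hg : Continuous g) {x : E} (hxG : x ∈ G)
    (hx : x ∉ criticalSet G g) :
    ∃ T > 0, ∃ η > 0, ∃ r > 0, ∀ᶠ n in atTop, dist (z n) x ≤ r →
      ∃ k, ∑ j ∈ Finset.range k, γ (n + j) ≤ T ∧ F (z (n + k)) ≤ F (z n) - η := by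
  have hM := H.M_pos
  obtain ⟨y, hyG, hy⟩ : ∃ y ∈ G, 0 < inner ℝ (g x) (x - y) := by
    by_contra! hcon
    exact hx ⟨hxG, fun y hy => by rw [inner_neg_left]; linarith [hcon y hy]⟩
  obtain ⟨c, hc, r, hr, hball⟩ : ∃ c > 0, ∃ r > 0, ∀ u, dist u x < r →
      c ≤ inner ℝ (g u) (u - y) := by
    have hcont : Continuous fun u => inner ℝ (g u) (u - y) := by fun_prop
    have hev := (hcont.tendsto x).eventually_const_lt (half_lt_self hy)
    obtain ⟨r, hr, hb⟩ := Metric.eventually_nhds_iff.mp hev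
    exact ⟨_, half_pos hy, r, hr, fun u hu => (hb hu).le⟩
  set D := (R + ‖y‖) ^ 2 + 1 with hD
  have hD0 : 0 < D := by positivity
  have hzD : ∀ n, ‖z n - y‖ ^ 2 ≤ D := fun n => by
    have h1 : ‖z n‖ ≤ R := by simpa using H.mem_ball n
    have h2 := norm_sub_le (z n) y
    have h3 := norm_nonneg (z n - y)
    nlinarith
  -- While `z` stays near `x`, the squared distance to `y`, at most `D`, decreases at rate `c`; so
  -- `z` cannot stay longer than `T`.
  set T := D / c with hTdef
  have hT : 0 < T := by positivity
  -- The average will travel at least `r / 4` in time at most `T`, so Cauchy–Schwarz bounds the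
  -- dissipated energy below by `r² / (16 T) = 4η`. Only `2η` is needed, one `η` paying for the
  -- error in `exists_scale`.
  set η := r ^ 2 / (64 * T) with hηdef
  have hη : 0 < η := by positivity
  obtain ⟨S, hS, hSr, hev⟩ := H.exists_scale hF hg hT hη (by positivity : 0 < r / 4)
  refine ⟨T, hT, η, hη, r / 2, by positivity, ?_⟩
  -- Expanding the square, the cross term is at most `2γ(c/4 - c)` and the quadratic one at most
  -- `γc/2`.
  have hdrift : ∀ᶠ n in atTop, dist (z n) x < r → ‖z (n + 1) - y‖ ^ 2 ≤ ‖z n - y‖ ^ 2 - γ n * c := by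
    filter_upwards [H.variational (c / 4) (by positivity),
      H.tendsto_zero.eventually_lt_const (by positivity : 0 < c / (2 * M ^ 2))] with n h1 h2 h3
    have h4 := h1 y hyG
    have h5 := hball _ h3
    rw [inner_add_left] at h4
    rw [lt_div_iff₀ (by positivity)] at h2
    have e : z (n + 1) - y = (z n - y) + γ n • h n := by rw [H.step]; abel
    have hγ := H.pos n
    rw [e, norm_add_sq_real, inner_smul_right, norm_smul, Real.norm_of_nonneg hγ.le, mul_pow,
      real_inner_comm]
    have h6 : ‖h n‖ ^ 2 ≤ M ^ 2 := pow_le_pow_left₀ (norm_nonneg _) (H.bound n) 2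
    have h7 : γ n ^ 2 * ‖h n‖ ^ 2 ≤ γ n * (c / 2) := by
      calc _ ≤ γ n ^ 2 * M ^ 2 := by gcongr
        _ = γ n * (γ n * M ^ 2) := by ring
        _ ≤ _ := by gcongr; linarith
    have h8 : γ n * inner ℝ (h n) (z n - y) ≤ γ n * (c / 4 - c) := by
      gcongr; linarith
    nlinarith
  filter_upwards [eventually_forall_ge_atTop.mpr hdrift, hev] with n hdr hn hnx
  have hexit : ∃ k, r ≤ dist (z (n + k)) x := by
    by_contra! hcon
    have hsum : ∀ k, ∑ j ∈ Finset.range k, γ (n + j) * c ≤ ‖z n - y‖ ^ 2 - ‖z (n + k) - y‖ ^ 2 := by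
      intro k
      induction k with
      | zero => simp
      | succ k ih =>
        rw [Finset.sum_range_succ]
        have := hdr (n + k) (by omega) (hcon k)
        rw [← add_assoc]; linarith
    have htop : Tendsto (fun k => ∑ j ∈ Finset.range k, γ (n + j)) atTop atTop := by
      have h1 := (tendsto_add_atTop_iff_nat n).mpr H.sum_infinite
      have h2 := tendsto_atTop_add_const_right atTop (-∑ k ∈ Finset.range n, γ k) h1
      refine h2.congr fun k => ?_
      rw [add_comm k n, Finset.sum_range_add]; ring
    obtain ⟨k, hk⟩ := (htop.eventually_gt_atTop T).exists
    have h1 := hsum k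
    rw [← Finset.sum_mul] at h1
    have h2 := hzD n
    have h3 := sq_nonneg ‖z (n + k) - y‖
    have h4 : T * c = D := by rw [hTdef]; field_simp
    have h5 := mul_lt_mul_of_pos_right hk hc
    linarith
  classical
  set k := Nat.find hexit with hk
  have hkr : r ≤ dist (z (n + k)) x := Nat.find_spec hexit
  have hlt : ∀ j < k, dist (z (n + j)) x < r := fun j hj => not_le.mp (Nat.find_min hexit hj)
  have hsum : ∀ i ≤ k,
      ∑ j ∈ Finset.range i, γ (n + j) * c ≤ ‖z n - y‖ ^ 2 - ‖z (n + i) - y‖ ^ 2 := by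
    intro i hi
    induction i with
    | zero => simp
    | succ i ih =>
      rw [Finset.sum_range_succ]
      have := hdr (n + i) (by omega) (hlt i (by omega))
      have := ih (by omega)
      rw [← add_assoc]; linarith
  have htime : ∑ j ∈ Finset.range k, γ (n + j) ≤ T := by
    rw [hTdef, le_div_iff₀ hc, Finset.sum_mul]
    have := hsum k le_rfl
    have h2 := hzD n
    have h3 := sq_nonneg ‖z (n + k) - y‖
    linarith
  refine ⟨k, htime, (hn.2 k htime).trans ?_⟩
  set a := movingAverage γ z S n
  set v : ℕ → E := fun j => (1 / S) • (z (n + j) - a j) with hv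
  have hdisp : ∀ i, ‖a i - z n‖ ≤ ∑ j ∈ Finset.range i, γ (n + j) * ‖v j‖ := by
    intro i
    induction i with
    | zero => simp [a, movingAverage]
    | succ i ih =>
      rw [Finset.sum_range_succ]
      have e : a (i + 1) - z n = (a i - z n) + γ (n + i) • v i := by
        simp only [a, hv, movingAverage, smul_smul, mul_one_div]; abel
      rw [e]
      refine (norm_add_le _ _).trans (add_le_add ih ?_)
      rw [norm_smul, Real.norm_of_nonneg (H.pos _).le]
  -- Of the exit distance `r`, `r / 2` may come from the starting point and `r / 4` from the gap
  -- between `z` and its average.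
  have hfar : r / 4 ≤ ∑ j ∈ Finset.range k, γ (n + j) * ‖v j‖ := by
    refine le_trans ?_ (hdisp k)
    have h1 : ‖z (n + k) - a k‖ ≤ r / 4 :=
      (norm_sub_movingAverage_le H.step H.bound hS hn.1 k).trans hSr
    have h2 : dist (z (n + k)) x ≤ dist (z (n + k)) (a k) + dist (a k) (z n) + dist (z n) x :=
      dist_triangle4 _ _ _ _
    rw [dist_eq_norm (z (n + k)) (a k), dist_eq_norm (a k) (z n)] at h2
    linarith
  have hquad : 2 * η ≤ ∑ j ∈ Finset.range k, γ (n + j) * ‖v j‖ ^ 2 := by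
    -- Cauchy–Schwarz in the form `‖v‖² ≥ 2β‖v‖ - β²`; this `β` yields `3η`.
    set β := r / (8 * T) with hβ
    have h1 : ∑ j ∈ Finset.range k, (2 * β * (γ (n + j) * ‖v j‖) - γ (n + j) * β ^ 2) ≤
        ∑ j ∈ Finset.range k, γ (n + j) * ‖v j‖ ^ 2 :=
      Finset.sum_le_sum fun j _ => by
        have := mul_nonneg (H.pos (n + j)).le (sq_nonneg (‖v j‖ - β))
        nlinarith
    rw [Finset.sum_sub_distrib, ← Finset.mul_sum, ← Finset.sum_mul] at h1
    have hβ0 : 0 < β := by positivity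
    have h2 : 2 * β * (r / 4) ≤ 2 * β * ∑ j ∈ Finset.range k, γ (n + j) * ‖v j‖ := by gcongr
    have h3 : (∑ j ∈ Finset.range k, γ (n + j)) * β ^ 2 ≤ T * β ^ 2 := by gcongr
    have h4 : 2 * β * (r / 4) - T * β ^ 2 = 3 * η := by
      rw [hβ, hηdef]; field_simp; ring
    linarith
  linarith

lemma AsympProjectedFlow.mem_of_tendsto_subseq (H : AsympProjectedFlow G g γ z h M R)
    {φ : ℕ → ℕ} (hφ : StrictMono φ) {x : E} (hx : Tendsto (z ∘ φ) atTop (𝓝 x)) : x ∈ G := by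
  rw [← H.compact.isClosed.closure_eq, Metric.closure_eq_iInter_cthickening]
  simp only [Set.mem_iInter]
  intro δ hδ
  exact Metric.isClosed_cthickening.mem_of_tendsto hx (hφ.tendsto_atTop.eventually (H.near δ hδ))

lemma AsympProjectedFlow.tendsto_step (H : AsympProjectedFlow G g γ z h M R) :
    Tendsto (fun n => z (n + 1) - z n) atTop (𝓝 0) := by
  have h1 : Tendsto (fun n => γ n * M) atTop (𝓝 0) := by simpa using H.tendsto_zero.mul_const M
  refine squeeze_zero_norm (fun n => ?_) h1
  rw [H.step, add_sub_cancel_left, norm_smul, Real.norm_of_nonneg (H.pos n).le]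
  exact mul_le_mul_of_nonneg_left (H.bound n) (H.pos n).le

/-- `F` along the flow cannot cross infinitely often a value that `F` does not take on the critical
set. -/
lemma AsympProjectedFlow.not_upcrossing [ProperSpace E] (H : AsympProjectedFlow G g γ z h M R)
    (hF : ∀ x, HasGradientAt F (g x) x) (hg : Continuous g) {c b : ℝ} (hcb : c < b)
    (hc : c ∉ F '' criticalSet G g) (hlow : ∃ᶠ n in atTop, F (z n) ≤ c)
    (hhigh : ∃ᶠ n in atTop, b ≤ F (z n)) : False := by
  have hFc : Continuous F := continuous_iff_continuousAt.mpr fun x => (hF x).continuousAt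
  -- Here `n` is the last time at or below `c` before the time `t` at height `b`.
  have hcross : ∃ᶠ n in atTop, F (z n) ≤ c ∧ c < F (z (n + 1)) ∧
      ∃ t > n, b ≤ F (z t) ∧ ∀ j, n < j → j ≤ t → c < F (z j) := by
    rw [frequently_atTop] at hlow hhigh ⊢
    intro N₀
    obtain ⟨s, hs, hsc⟩ := hlow N₀
    obtain ⟨t, ht, htb⟩ := hhigh s
    classical
    set n := Nat.findGreatest (fun m => F (z m) ≤ c) t with hn
    have hsn : s ≤ n := Nat.le_findGreatest ht hsc
    have hnc : F (z n) ≤ c := Nat.findGreatest_spec (P := fun m => F (z m) ≤ c) ht hsc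
    have hnt : n ≤ t := Nat.findGreatest_le t
    have hne : n ≠ t := fun h => by rw [h] at hnc; linarith
    have hgt : ∀ j, n < j → j ≤ t → c < F (z j) := fun j h1 h2 =>
      not_le.mp (Nat.findGreatest_is_greatest (P := fun m => F (z m) ≤ c) h1 h2)
    exact ⟨n, hs.trans hsn, hnc, hgt _ (by omega) (by omega), t, by omega, htb, hgt⟩
  obtain ⟨φ, hφ, hφc⟩ := extraction_of_frequently_atTop hcross
  obtain ⟨x, -, ψ, hψ, hx⟩ := (isCompact_closedBall (0 : E) R).tendsto_subseq
    (fun k => H.mem_ball (φ k))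
  have hφψ : StrictMono (φ ∘ ψ) := hφ.comp hψ
  have hx' : Tendsto (z ∘ (φ ∘ ψ)) atTop (𝓝 x) := hx
  have hxG := H.mem_of_tendsto_subseq hφψ hx'
  have hx1 : Tendsto (fun k => z (φ (ψ k) + 1)) atTop (𝓝 x) := by
    have h1 := (H.tendsto_step.comp hφψ.tendsto_atTop).add hx'
    simpa using h1
  have hFx : F x = c := by
    refine le_antisymm ?_ ?_
    · exact le_of_tendsto ((hFc.tendsto x).comp hx') (Eventually.of_forall fun k => (hφc (ψ k)).1)
    · exact ge_of_tendsto ((hFc.tendsto x).comp hx1)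
        (Eventually.of_forall fun k => (hφc (ψ k)).2.1.le)
  have hxL : x ∉ criticalSet G g := fun hL => hc ⟨x, hL, hFx⟩
  obtain ⟨T, hT, η, hη, r, hr, hdec⟩ := H.exists_decrease hF hg hxG hxL
  have hmono := H.almost_decreasing hF hg hT (half_pos (sub_pos.mpr hcb))
  have hclose : ∀ᶠ k in atTop, dist (z (φ (ψ k))) x ≤ r :=
    (Metric.tendsto_nhds.mp hx' r hr).mono fun k hk => hk.le
  obtain ⟨k, hk1, hk2, hk3⟩ := (hclose.and ((hφψ.tendsto_atTop.eventually hdec).and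
    (hφψ.tendsto_atTop.eventually hmono))).exists
  obtain ⟨h1, -, t, htn, htb, hgt⟩ := hφc (ψ k)
  simp only [Function.comp_apply] at hk2 hk3
  set n := φ (ψ k)
  obtain ⟨i, hiT, hi⟩ := hk2 hk1
  -- A drop of `η` from `F (z n) ≤ c` ends below `c`, which cannot happen between `n` and `t`. Hence
  -- `t` comes within time `T` of `n`, and almost monotonicity forbids the rise from `c` to `b`.
  have hti : t - n ≤ i := by
    by_contra! hcon
    rcases Nat.eq_zero_or_pos i with h0 | h0
    · rw [h0, add_zero] at hi; linarith
    · have := hgt (n + i) (by omega) (by omega)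
      linarith
  have hle : ∑ j ∈ Finset.range (t - n), γ (n + j) ≤ T :=
    (Finset.sum_le_sum_of_subset_of_nonneg (Finset.range_mono hti)
      (fun j _ _ => (H.pos _).le)).trans hiT
  have h2 := hk3 (t - n) hle
  rw [show n + (t - n) = t by omega] at h2
  linarith

/-- If `F` takes no interval of values on the critical set, every limit point of the flow is
critical. -/
theorem AsympProjectedFlow.limit_mem_criticalSet [ProperSpace E]
    (H : AsympProjectedFlow G g γ z h M R)
    (hF : ∀ x, HasGradientAt F (g x) x) (hg : Continuous g)
    (hint : interior (F '' criticalSet G g) = ∅) {φ : ℕ → ℕ} (hφ : StrictMono φ) {x : E}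
    (hx : Tendsto (z ∘ φ) atTop (𝓝 x)) : x ∈ criticalSet G g := by
  by_contra hxL
  have hFc : Continuous F := continuous_iff_continuousAt.mpr fun x => (hF x).continuousAt
  obtain ⟨T, hT, η, hη, r, hr, hdec⟩ := H.exists_decrease hF hg
    (H.mem_of_tendsto_subseq hφ hx) hxL
  have hFx : Tendsto (fun k => F (z (φ k))) atTop (𝓝 (F x)) := (hFc.tendsto x).comp hx
  -- Visits near `x` have values above `F x - η / 4` and below `F x + η / 2`; the subsequent drop by
  -- `η` leads below `F x - η / 2 < c`.
  obtain ⟨c, hc, hcL⟩ : ∃ c ∈ Set.Ioo (F x - η / 2) (F x - η / 4), c ∉ F '' criticalSet G g := by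
    by_contra! hcon
    have h1 : Set.Ioo (F x - η / 2) (F x - η / 4) ⊆ interior (F '' criticalSet G g) :=
      interior_maximal hcon isOpen_Ioo
    rw [hint] at h1
    exact (Set.nonempty_Ioo.mpr (by linarith)).ne_empty (Set.subset_empty_iff.mp h1)
  refine H.not_upcrossing hF hg hc.2 hcL ?_ ?_
  · rw [frequently_atTop]
    intro N₀
    have e1 : ∀ᶠ k in atTop, F (z (φ k)) < F x + η / 2 := hFx.eventually_lt_const (by linarith)
    have e2 : ∀ᶠ k in atTop, dist (z (φ k)) x ≤ r :=
      (Metric.tendsto_nhds.mp hx r hr).mono fun k hk => hk.le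
    obtain ⟨k, h1, h2, h3, h4⟩ := (e1.and (e2.and ((hφ.tendsto_atTop.eventually hdec).and
      (hφ.tendsto_atTop.eventually_ge_atTop N₀)))).exists
    obtain ⟨i, -, hi⟩ := h3 h2
    exact ⟨φ k + i, by omega, by linarith [hc.1]⟩
  · have e1 : ∀ᶠ k in atTop, F x - η / 4 < F (z (φ k)) := hFx.eventually_const_lt (by linarith)
    exact hφ.tendsto_atTop.frequently (e1.mono fun k hk => hk.le).frequently

end Deterministic

/-! ### Cluster sets of sequences with vanishing steps. -/

section LimitSets

/-- Discrete intermediate value principle: once steps are shorter than `b - a`, the first time after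
the last value at or below `a` cannot jump past `b`. -/
lemma frequently_mem_Icc_of_tendsto_step {s : ℕ → ℝ}
    (hstep : Tendsto (fun n => s (n + 1) - s n) atTop (𝓝 0))
    {a b : ℝ} (hab : a < b) (hlow : ∃ᶠ n in atTop, s n ≤ a) (hhigh : ∃ᶠ n in atTop, b ≤ s n) :
    ∃ᶠ n in atTop, s n ∈ Set.Icc a b := by
  obtain ⟨N₁, hN₁⟩ := eventually_atTop.mp
    (hstep.eventually_lt_const (sub_pos.mpr hab))
  rw [frequently_atTop] at hlow hhigh ⊢
  intro N₀
  obtain ⟨l, hl, hla⟩ := hlow (max N₀ N₁)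
  obtain ⟨t, ht, htb⟩ := hhigh l
  classical
  set n := Nat.findGreatest (fun m => s m ≤ a) t with hn
  have hsn : l ≤ n := Nat.le_findGreatest ht hla
  have hnc : s n ≤ a := Nat.findGreatest_spec (P := fun m => s m ≤ a) ht hla
  have hnt : n ≤ t := Nat.findGreatest_le t
  have hne : n ≠ t := fun h => by rw [h] at hnc; linarith
  have hgt : a < s (n + 1) := not_le.mp
    (Nat.findGreatest_is_greatest (P := fun m => s m ≤ a) (Nat.lt_succ_self n) (by omega))
  have h1 := hN₁ n ((le_max_right _ _).trans (hl.trans hsn))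
  exact ⟨n + 1, by have := le_max_left N₀ N₁; omega, hgt.le, by linarith⟩

variable {E : Type*} [MetricSpace E] {x : ℕ → E} {K : Set E}

/-- Terms that stay away from the cluster set infinitely often would, by compactness, produce a
cluster point away from it. -/
lemma convergesToSet_clusterPts (hK : IsCompact K) (hx : ∀ᶠ n in atTop, x n ∈ K) :
    ConvergesToSet x {a | MapClusterPt a atTop x} := by
  rw [ConvergesToSet, ENNReal.tendsto_nhds_zero]
  intro ε hε
  by_contra hcon
  rw [not_eventually] at hcon
  have hcl : IsClosed {u : E | ε ≤ Metric.infEDist u {a | MapClusterPt a atTop x}} :=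
    isClosed_le continuous_const Metric.continuous_infEDist
  obtain ⟨a, ha, hac⟩ := (hK.inter_right hcl).exists_mapClusterPt_of_frequently (l := atTop) (f := x)
    ((hcon.and_eventually hx).mono fun n hn => ⟨hn.2, (not_le.mp hn.1).le⟩)
  have h1 : ε ≤ Metric.infEDist a {a | MapClusterPt a atTop x} := ha.2
  rw [Metric.infEDist_zero_of_mem (show a ∈ {a | MapClusterPt a atTop x} from hac)] at h1
  exact hε.not_ge h1

/-- If the cluster set split into two pieces at distance `δ`, the sequence would visit both
infinitely often. Its distance to one piece would then lie in `[δ/3, 2δ/3]` infinitely often, giving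
a cluster point in neither. -/
lemma isPreconnected_clusterPts (hK : IsCompact K) (hx : ∀ᶠ n in atTop, x n ∈ K)
    (hstep : Tendsto (fun n => dist (x (n + 1)) (x n)) atTop (𝓝 0)) :
    IsPreconnected {a | MapClusterPt a atTop x} := by
  set A := {a | MapClusterPt a atTop x} with hA
  have hAcl : IsClosed A := isClosed_setOfPred_clusterPt
  have hAK : A ⊆ K := fun a ha => hK.isClosed.mem_of_mapClusterPt ha hx
  have hAc : IsCompact A := hK.of_isClosed_subset hAcl hAK
  rw [isPreconnected_iff_subset_of_fully_disjoint_closed hAcl]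
  intro u v hu hv huv hdisj
  by_contra! hcon
  obtain ⟨⟨a, haA, hau⟩, ⟨b, hbA, hbv⟩⟩ :
      (∃ a ∈ A, a ∉ u) ∧ (∃ b ∈ A, b ∉ v) := ⟨Set.not_subset.mp hcon.1, Set.not_subset.mp hcon.2⟩
  have hb : b ∈ A ∩ u := ⟨hbA, (huv hbA).resolve_right hbv⟩
  have ha : a ∈ A ∩ v := ⟨haA, (huv haA).resolve_left hau⟩
  have hd : Disjoint (A ∩ u) (A ∩ v) := hdisj.mono Set.inter_subset_right Set.inter_subset_right
  obtain ⟨δ, hδ, hthick⟩ := hd.exists_thickenings (hAc.inter_right hu) (hAcl.inter hv)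
  have hsep : ∀ c ∈ A ∩ v, δ ≤ Metric.infDist c (A ∩ u) := by
    intro c hc
    by_contra! hlt
    have h1 : c ∈ Metric.thickening δ (A ∩ u) := by
      rw [Metric.mem_thickening_iff]
      obtain ⟨w, hw, hcw⟩ := (Metric.infDist_lt_iff ⟨b, hb⟩).mp hlt
      exact ⟨w, hw, hcw⟩
    exact Set.disjoint_left.mp hthick h1 (Metric.self_subset_thickening hδ _ hc)
  have hcont : Continuous fun c => Metric.infDist c (A ∩ u) := Metric.continuous_infDist_pt _
  have hmid : ∃ᶠ n in atTop, Metric.infDist (x n) (A ∩ u) ∈ Set.Icc (δ / 3) (2 * δ / 3) := by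
    refine frequently_mem_Icc_of_tendsto_step ?_ (by linarith) ?_ ?_
    · refine squeeze_zero_norm (fun n => ?_) hstep
      have := (Metric.lipschitz_infDist_pt (A ∩ u)).dist_le_mul (x (n + 1)) (x n)
      simpa [Real.dist_eq] using this
    · have h0 : Metric.infDist b (A ∩ u) < δ / 3 := by
        rw [Metric.infDist_zero_of_mem hb]; positivity
      exact (MapClusterPt.frequently hbA (hcont.continuousAt.eventually_lt_const h0)).mono
        fun n hn => hn.le
    · have h0 : 2 * δ / 3 < Metric.infDist a (A ∩ u) := by
        have := hsep a ha; linarith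
      exact (MapClusterPt.frequently haA (hcont.continuousAt.eventually_const_lt h0)).mono
        fun n hn => hn.le
  obtain ⟨c, hc, hcA⟩ := (hK.inter_right (isClosed_Icc.preimage hcont)).exists_mapClusterPt_of_frequently
    (l := atTop) (f := x) ((hmid.and_eventually hx).mono fun n hn => ⟨hn.2, hn.1⟩)
  have hc2 : Metric.infDist c (A ∩ u) ∈ Set.Icc (δ / 3) (2 * δ / 3) := hc.2
  have hcA' : c ∈ A := hcA
  rcases huv hcA' with h | h
  · rw [Metric.infDist_zero_of_mem (show c ∈ A ∩ u from ⟨hcA', h⟩)] at hc2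
    linarith [hc2.1]
  · linarith [hc2.2, hsep c ⟨hcA', h⟩]

/-- A relatively compact sequence with vanishing steps whose limit points lie in `L` converges to a
connected component of `L`. -/
lemma exists_convergesToSet_connectedComponentIn {L : Set E} (hK : IsCompact K)
    (hx : ∀ᶠ n in atTop, x n ∈ K)
    (hstep : Tendsto (fun n => dist (x (n + 1)) (x n)) atTop (𝓝 0))
    (hL : ∀ a, MapClusterPt a atTop x → a ∈ L) :
    ∃ θ ∈ L, ConvergesToSet x (connectedComponentIn L θ) := by
  obtain ⟨θ, -, hθ⟩ := hK.exists_mapClusterPt_of_frequently (l := atTop) (f := x) hx.frequently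
  refine ⟨θ, hL θ hθ, ?_⟩
  have hsub : {a | MapClusterPt a atTop x} ⊆ connectedComponentIn L θ :=
    (isPreconnected_clusterPts hK hx hstep).subset_connectedComponentIn hθ fun a ha => hL a ha
  exact tendsto_of_tendsto_of_tendsto_of_le_of_le tendsto_const_nhds
    (convergesToSet_clusterPts hK hx) (fun _ => zero_le) (fun _ => Metric.infEDist_anti hsub)

end LimitSets

/-! ### Euclidean projection onto a closed convex set. -/

section Projection

variable {d : ℕ} {G : Set (Vec d)}

lemma proj_spec (hne : G.Nonempty) (hcl : IsClosed G) (x : Vec d) :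
    proj G x ∈ G ∧ ∀ z ∈ G, dist x (proj G x) ≤ dist x z := by
  refine Classical.epsilon_spec (p := fun y => y ∈ G ∧ ∀ z ∈ G, dist x y ≤ dist x z) ?_
  obtain ⟨y, hy, hxy⟩ := hcl.exists_infDist_eq_dist hne x
  exact ⟨y, hy, fun z hz => hxy ▸ Metric.infDist_le_dist_of_mem hz⟩

lemma inner_sub_proj_nonpos (hne : G.Nonempty) (hcl : IsClosed G) (hconv : Convex ℝ G) (x : Vec d)
    {y : Vec d} (hy : y ∈ G) : inner ℝ (x - proj G x) (y - proj G x) ≤ 0 := by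
  obtain ⟨h1, h2⟩ := proj_spec hne hcl x
  have : Nonempty G := hne.to_subtype
  refine (norm_eq_iInf_iff_real_inner_le_zero hconv h1).mp ?_ y hy
  refine le_antisymm (le_ciInf fun w => ?_) (ciInf_le ⟨0, ?_⟩ (⟨proj G x, h1⟩ : G))
  · simpa only [dist_eq_norm] using h2 w w.2
  · rintro _ ⟨w, rfl⟩; exact norm_nonneg _

lemma norm_proj_sub_proj_le (hne : G.Nonempty) (hcl : IsClosed G) (hconv : Convex ℝ G)
    (x y : Vec d) : ‖proj G x - proj G y‖ ≤ ‖x - y‖ := by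
  have h1 := inner_sub_proj_nonpos hne hcl hconv x (proj_spec hne hcl y).1
  have h2 := inner_sub_proj_nonpos hne hcl hconv y (proj_spec hne hcl x).1
  set a := proj G x
  set b := proj G y
  have h3 : ‖a - b‖ ^ 2 ≤ inner ℝ (x - y) (a - b) := by
    have e : inner ℝ (x - y) (a - b) - ‖a - b‖ ^ 2 =
        -inner ℝ (x - a) (b - a) - inner ℝ (y - b) (a - b) := by
      rw [← real_inner_self_eq_norm_sq, ← inner_sub_left, ← inner_neg_right, neg_sub,
        ← inner_sub_left]
      congr 1; abel
    linarith
  have h4 := real_inner_le_norm (x - y) (a - b)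
  rcases (norm_nonneg (a - b)).eq_or_lt with h0 | h0
  · rw [← h0]; exact norm_nonneg _
  · nlinarith

lemma proj_eq_self (hne : G.Nonempty) (hcl : IsClosed G) {x : Vec d} (hx : x ∈ G) :
    proj G x = x := by
  have := (proj_spec hne hcl x).2 x hx
  rw [dist_self] at this
  exact (dist_le_zero.mp this).symm

lemma continuous_proj (hne : G.Nonempty) (hcl : IsClosed G) (hconv : Convex ℝ G) :
    Continuous (proj G) :=
  (LipschitzWith.of_dist_le_mul (K := 1) fun x y => by
    simpa [dist_eq_norm] using norm_proj_sub_proj_le hne hcl hconv x y).continuous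

end Projection

/-! ### Deterministic recursions for the mean square disagreement. -/

section Recursion

/-- The rescaled sequence `n^β U n` stays bounded. Passing from `n^β` to `(n+1)^β` costs a factor of
about `1 + β/n`, which half of the contraction absorbs because `n δ n → ∞`. The other half gives `(1
- δ/2) x + C δ ≤ max x (2C)`. -/
lemma summable_of_contraction {U δ : ℕ → ℝ} {β C : ℝ} (hβ : 1 < β) (hU : ∀ n, 0 ≤ U n)
    (hδ : Tendsto (fun n : ℕ => (n : ℝ) * δ n) atTop atTop) (hδ1 : ∀ᶠ n in atTop, δ n ≤ 1)
    (hrec : ∀ᶠ n : ℕ in atTop, U (n + 1) ≤ (1 - δ (n + 1)) * U n +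
      C * δ (n + 1) * ((n : ℝ) + 1) ^ (-β)) : Summable U := by
  have ev : ∀ᶠ n : ℕ in atTop, ((n : ℝ) + 1) ^ β * U (n + 1) ≤
      max ((n : ℝ) ^ β * U n) (2 * C) := by
    have e1 := (tendsto_add_atTop_iff_nat 1).mpr hδ
    filter_upwards [hrec, (tendsto_add_atTop_nat 1).eventually hδ1,
      e1.eventually_ge_atTop (2 * β), eventually_ge_atTop 1] with n h1 h2 h3 h4
    push_cast at h3
    set D := δ (n + 1)
    set t : ℝ := (n : ℝ) + 1 with ht
    have ht0 : 0 < t := by positivity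
    have hn1 : (1 : ℝ) ≤ n := by exact_mod_cast h4
    have hD0 : 0 < D := by
      by_contra! hcon
      nlinarith
    -- Bernoulli for `(1 - 1/t)^β`, together with `β/t ≤ D/2`.
    have hbern : t ^ β * (1 - D / 2) ≤ (n : ℝ) ^ β := by
      have h5 : 1 + β * (-(1 / t)) ≤ (1 + -(1 / t)) ^ β := by
        refine one_add_mul_self_le_rpow_one_add ?_ hβ.le
        rw [neg_le_neg_iff, div_le_one ht0]; linarith
      have h6 : (n : ℝ) = t * (1 + -(1 / t)) := by field_simp; rw [ht]; ring
      have h7 : (0 : ℝ) ≤ 1 + -(1 / t) := by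
        have : 1 / t ≤ 1 := by rw [div_le_one ht0]; linarith
        linarith
      rw [h6, Real.mul_rpow ht0.le h7]
      refine mul_le_mul_of_nonneg_left (le_trans ?_ h5) (by positivity)
      have : β / t ≤ D / 2 := by rw [div_le_iff₀ ht0]; linarith
      rw [mul_neg, mul_one_div]; linarith
    have hpow : t ^ β * t ^ (-β) = 1 := by rw [← Real.rpow_add ht0]; simp
    have h8 : t ^ β * U (n + 1) ≤ (1 - D) * (t ^ β * U n) + C * D := by
      have := mul_le_mul_of_nonneg_left h1 (by positivity : 0 ≤ t ^ β)
      calc _ ≤ _ := this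
        _ = (1 - D) * (t ^ β * U n) + C * D * (t ^ β * t ^ (-β)) := by ring
        _ = _ := by rw [hpow]; ring
    have h9 : (1 - D) * (t ^ β * U n) ≤ (1 - D / 2) * ((n : ℝ) ^ β * U n) := by
      have h10 : 0 ≤ t ^ β * U n := mul_nonneg (by positivity) (hU n)
      have h11 : (1 - D) ≤ (1 - D / 2) * (1 - D / 2) := by nlinarith
      calc _ ≤ (1 - D / 2) * (1 - D / 2) * (t ^ β * U n) := by gcongr
        _ = (1 - D / 2) * (t ^ β * (1 - D / 2) * U n) := by ring
        _ ≤ _ := mul_le_mul_of_nonneg_left (mul_le_mul_of_nonneg_right hbern (hU n))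
            (by linarith)
    have h12 := le_max_left ((n : ℝ) ^ β * U n) (2 * C)
    have h13 := le_max_right ((n : ℝ) ^ β * U n) (2 * C)
    set m := max ((n : ℝ) ^ β * U n) (2 * C)
    calc _ ≤ (1 - D / 2) * m + D / 2 * m := by
          have a1 := mul_le_mul_of_nonneg_left h12 (by linarith : 0 ≤ 1 - D / 2)
          have a2 := mul_le_mul_of_nonneg_left h13 (by linarith : 0 ≤ D / 2)
          linarith
      _ = m := by ring
  obtain ⟨n₀, hn₀⟩ := eventually_atTop.mp ev
  set B := max ((n₀ : ℝ) ^ β * U n₀) (2 * C)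
  have hB : ∀ n ≥ n₀, (n : ℝ) ^ β * U n ≤ B := by
    intro n hn
    induction n, hn using Nat.le_induction with
    | base => exact le_max_left _ _
    | succ n hn ih =>
      push_cast
      exact (hn₀ n hn).trans (max_le ih (le_max_right _ _))
  have hs : Summable fun n : ℕ => B * (n : ℝ) ^ (-β) :=
    (Real.summable_nat_rpow.mpr (by linarith)).mul_left B
  refine summable_of_isBigO_nat hs (Asymptotics.IsBigO.of_bound 1 ?_)
  filter_upwards [eventually_ge_atTop (max n₀ 1)] with n hn
  have hn0 : (0 : ℝ) < n := by
    have := le_max_right n₀ 1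
    exact_mod_cast (by omega : 0 < n)
  have h1 := hB n ((le_max_left _ _).trans hn)
  have h2 : U n ≤ B * (n : ℝ) ^ (-β) := by
    rw [Real.rpow_neg hn0.le, ← div_eq_mul_inv, le_div_iff₀ (by positivity), mul_comm]
    exact h1
  rw [one_mul, Real.norm_of_nonneg (hU n)]
  exact h2.trans (le_abs_self _)

lemma StepAssumption.summable_sq {γ ρ : ℕ → ℝ} (h : StepAssumption γ ρ) :
    Summable fun n => γ n ^ 2 := by
  obtain ⟨α, hα, hlim, -⟩ := h.rate
  refine summable_of_isBigO_nat (Real.summable_nat_rpow.mpr (by linarith : -(2 * α) < -1))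
    (Asymptotics.IsBigO.of_bound 1 ?_)
  filter_upwards [hlim.eventually_lt_const one_pos, eventually_ge_atTop 1] with n h1 h2
  have hn0 : (0 : ℝ) < n := by exact_mod_cast h2
  have h3 := h.pos n h2
  have h4 : γ n ≤ (n : ℝ) ^ (-α) := by
    rw [Real.rpow_neg hn0.le, ← one_div, le_div_iff₀ (by positivity), mul_comm]; exact h1.le
  have h5 : ((n : ℝ) ^ (-α)) ^ 2 = (n : ℝ) ^ (-(2 * α)) := by
    rw [← Real.rpow_natCast, ← Real.rpow_mul hn0.le]; congr 1; push_cast; ring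
  rw [one_mul, Real.norm_of_nonneg (by positivity), Real.norm_of_nonneg (by positivity), ← h5]
  gcongr

lemma StepAssumption.tendsto_zero {γ ρ : ℕ → ℝ} (h : StepAssumption γ ρ) :
    Tendsto γ atTop (𝓝 0) := by
  have h1 := h.summable_sq.tendsto_atTop_zero
  have h2 := h1.sqrt
  rw [Real.sqrt_zero] at h2
  refine squeeze_zero_norm (fun n => ?_) h2
  rw [Real.sqrt_sq_eq_abs, Real.norm_eq_abs]

/-- The lower limit bounds `γ` by a multiple of `(1 - ρ) n^(-α)`, so the forcing term becomes the
contraction gap times `n^(-2α)`, and `2α > 1`. -/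
lemma StepAssumption.summable_disagreement {γ ρ U : ℕ → ℝ} (h : StepAssumption γ ρ)
    (hρ0 : ∀ n, 0 ≤ ρ n) (hρ : Tendsto (fun n : ℕ => (n : ℝ) * (1 - ρ n)) atTop atTop)
    (hU : ∀ n, 0 ≤ U n) {K : ℝ} (hK : 0 ≤ K)
    (hrec : ∀ n, 1 ≤ n → ∀ η > 0, U (n + 1) ≤ ρ (n + 1) *
      ((1 + η) * U n + (1 + 1 / η) * (γ (n + 1) ^ 2 * K))) : Summable U := by
  obtain ⟨α, hα, -, hinf⟩ := h.rate
  -- A real `c` strictly below the lower limit, which also covers an infinite lower limit.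
  obtain ⟨c, hc0, hc⟩ : ∃ c : ℝ, 0 < c ∧
      (c : EReal) < liminf (fun n : ℕ => (((1 - ρ n) / ((n : ℝ) ^ α * γ n) : ℝ) : EReal)) atTop := by
    obtain ⟨c, h1, h2⟩ := EReal.lt_iff_exists_real_btwn.mp hinf
    exact ⟨c, by exact_mod_cast h1, h2⟩
  have hev := eventually_lt_of_lt_liminf hc
  set δ : ℕ → ℝ := fun n => (1 - ρ n) / 2 with hδ
  have hδt : Tendsto (fun n : ℕ => (n : ℝ) * δ n) atTop atTop := by
    have : (fun n : ℕ => (n : ℝ) * δ n) = fun n : ℕ => ((n : ℝ) * (1 - ρ n)) / 2 := by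
      ext n; simp only [hδ]; ring
    rw [this]
    exact hρ.atTop_div_const (by norm_num)
  refine summable_of_contraction (δ := δ) (C := 8 * K / c ^ 2) (by linarith : 1 < 2 * α) hU hδt
    (Eventually.of_forall fun n => by simp only [hδ]; linarith [hρ0 n]) ?_
  filter_upwards [(tendsto_add_atTop_nat 1).eventually hev,
    (tendsto_add_atTop_nat 1).eventually (hδt.eventually_gt_atTop 0), eventually_ge_atTop 1]
    with n h1 h2 h3
  have h1' : c < (1 - ρ (n + 1)) / (((n + 1 : ℕ) : ℝ) ^ α * γ (n + 1)) := by exact_mod_cast h1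
  have hγ := h.pos (n + 1) (by omega)
  push_cast at h1' h2
  set t : ℝ := (n : ℝ) + 1 with ht
  have ht0 : 0 < t := by positivity
  have hD0 : 0 < δ (n + 1) := pos_of_mul_pos_right h2 ht0.le
  have hρD : ρ (n + 1) = 1 - 2 * δ (n + 1) := by simp only [hδ]; ring
  have hρ1 := hρ0 (n + 1)
  -- The free parameter is taken to be `η = δ = (1 - ρ)/2`, so that `ρ (1 + η) = (1 - 2δ)(1 + δ) ≤ 1
  -- - δ`.
  refine (hrec n h3 _ hD0).trans ?_
  rw [show 1 - ρ (n + 1) = 2 * δ (n + 1) by linarith, lt_div_iff₀ (by positivity)] at h1'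
  rw [hρD] at hρ1 ⊢
  set D := δ (n + 1)
  have hUn := hU n
  have hγD : γ (n + 1) ^ 2 ≤ 4 * D ^ 2 / c ^ 2 * t ^ (-(2 * α)) := by
    have h5 : (t ^ (-α)) ^ 2 = t ^ (-(2 * α)) := by
      rw [← Real.rpow_natCast, ← Real.rpow_mul ht0.le]; congr 1; push_cast; ring
    have h6 : γ (n + 1) ≤ 2 * D / c * t ^ (-α) := by
      rw [Real.rpow_neg ht0.le, ← div_eq_mul_inv, le_div_iff₀ (by positivity), le_div_iff₀ hc0]
      nlinarith
    calc _ ≤ (2 * D / c * t ^ (-α)) ^ 2 := by gcongr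
      _ = _ := by rw [mul_pow, h5]; ring
  have hA : (1 - 2 * D) * (1 + D) * U n ≤ (1 - D) * U n :=
    mul_le_mul_of_nonneg_right (by nlinarith) hUn
  have hB : (1 - 2 * D) * ((1 + 1 / D) * (γ (n + 1) ^ 2 * K)) ≤
      8 * K / c ^ 2 * D * t ^ (-(2 * α)) := by
    have h7 : (1 - 2 * D) * (1 + 1 / D) ≤ 2 / D := by
      rw [le_div_iff₀ hD0]
      have : (1 - 2 * D) * (1 + 1 / D) * D = (1 - 2 * D) * (D + 1) := by field_simp
      rw [this]; nlinarith
    calc _ = (1 - 2 * D) * (1 + 1 / D) * (γ (n + 1) ^ 2 * K) := by ring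
      _ ≤ 2 / D * ((4 * D ^ 2 / c ^ 2 * t ^ (-(2 * α))) * K) := by
          gcongr
      _ = _ := by field_simp; ring
  linarith

end Recursion

/-! ### Martingale series, conditional moments and independence. -/

section Probability

variable {Ω : Type*} {m mΩ : MeasurableSpace Ω} {P : Measure Ω}

lemma ae_tendsto_zero_of_summable_integral {X : ℕ → Ω → ℝ} (hX : ∀ n, Integrable (X n) P)
    (h0 : ∀ n, 0 ≤ᵐ[P] X n) (hs : Summable fun n => ∫ ω, X n ω ∂P) :
    ∀ᵐ ω ∂P, Tendsto (fun n => X n ω) atTop (𝓝 0) := by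
  have h1 : ∑' n, ∫⁻ ω, ENNReal.ofReal (X n ω) ∂P < ⊤ := by
    have : ∀ n, ∫⁻ ω, ENNReal.ofReal (X n ω) ∂P = ENNReal.ofReal (∫ ω, X n ω ∂P) := fun n =>
      (ofReal_integral_eq_lintegral_ofReal (hX n) (h0 n)).symm
    simp_rw [this]
    rw [← ENNReal.ofReal_tsum_of_nonneg (fun n => integral_nonneg_of_ae (h0 n)) hs]
    exact ENNReal.ofReal_lt_top
  rw [← lintegral_tsum fun n => (hX n).aemeasurable.ennreal_ofReal] at h1
  have h2 := ae_lt_top' (AEMeasurable.tsum fun n => (hX n).aemeasurable.ennreal_ofReal)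
    h1.ne
  filter_upwards [h2, ae_all_iff.mpr h0] with ω hω h0ω
  have h3 := ENNReal.tendsto_atTop_zero_of_tsum_ne_top hω.ne
  have h4 := (ENNReal.tendsto_toReal ENNReal.zero_ne_top).comp h3
  refine (h4.congr fun n => ?_)
  simp only [Function.comp_apply]
  exact ENNReal.toReal_ofReal (h0ω n)

/-- A series of real martingale differences with summable variances converges almost surely. -/
lemma ae_exists_tendsto_sum_real [IsProbabilityMeasure P] {ℱ : Filtration ℕ mΩ}
    {X : ℕ → Ω → ℝ} (hmeas : ∀ n, StronglyMeasurable[ℱ (n + 1)] (X n))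
    (hL2 : ∀ n, MemLp (X n) 2 P) (hcond : ∀ n, P[X n | ℱ n] =ᵐ[P] 0)
    (hs : Summable fun n => ∫ ω, X n ω ^ 2 ∂P) :
    ∀ᵐ ω ∂P, ∃ c, Tendsto (fun n => ∑ k ∈ Finset.range n, X k ω) atTop (𝓝 c) := by
  set S : ℕ → Ω → ℝ := fun n ω => ∑ k ∈ Finset.range n, X k ω with hS
  have hSsucc : ∀ n, S (n + 1) = S n + X n := fun n => by
    ext ω; simp [hS, Finset.sum_range_succ]
  have hSm : ∀ n, StronglyMeasurable[ℱ n] (S n) := fun n =>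
    Finset.stronglyMeasurable_fun_sum _ fun k hk =>
      (hmeas k).mono (ℱ.mono (Finset.mem_range.mp hk))
  have hSL2 : ∀ n, MemLp (S n) 2 P := fun n => memLp_finsetSum _ fun k _ => hL2 k
  have hint : ∀ n, Integrable (X n) P := fun n => (hL2 n).integrable (by norm_num)
  have hSint : ∀ n, Integrable (S n) P := fun n => (hSL2 n).integrable (by norm_num)
  have hmart : Martingale S ℱ P := by
    refine martingale_nat hSm hSint fun n => ?_
    rw [hSsucc]
    have h1 := condExp_add (hSint n) (hint n) (ℱ n)
    have h2 : P[S n | ℱ n] = S n := condExp_of_stronglyMeasurable (ℱ.le n) (hSm n) (hSint n)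
    filter_upwards [h1, hcond n] with ω hω1 hω2
    rw [hω1, Pi.add_apply, h2, hω2]; simp
  have horth : ∀ n, ∫ ω, S n ω * X n ω ∂P = 0 := fun n => by
    have h1 : P[S n * X n | ℱ n] =ᵐ[P] S n * P[X n | ℱ n] :=
      condExp_mul_of_stronglyMeasurable_left (hSm n) ((hSL2 n).integrable_mul (hL2 n)) (hint n)
    have h2 : ∫ ω, (P[S n * X n | ℱ n]) ω ∂P = ∫ ω, (S n * X n) ω ∂P := integral_condExp (ℱ.le n)
    have h3 : ∫ ω, (P[S n * X n | ℱ n]) ω ∂P = 0 := by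
      rw [integral_eq_zero_of_ae]
      filter_upwards [h1, hcond n] with ω hω1 hω2
      rw [hω1, Pi.mul_apply, hω2]; simp
    rw [h3] at h2
    exact h2.symm
  have hvar : ∀ n, ∫ ω, S n ω ^ 2 ∂P = ∑ k ∈ Finset.range n, ∫ ω, X k ω ^ 2 ∂P := by
    intro n
    induction n with
    | zero => simp [hS]
    | succ n ih =>
      rw [Finset.sum_range_succ, ← ih]
      have e : ∀ ω, S (n + 1) ω ^ 2 = S n ω ^ 2 + 2 * (S n ω * X n ω) + X n ω ^ 2 := fun ω => by
        rw [hSsucc, Pi.add_apply]; ring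
      have i1 : Integrable (fun ω => S n ω * X n ω) P := (hSL2 n).integrable_mul (hL2 n)
      simp_rw [e]
      have i2 : Integrable (fun ω => S n ω ^ 2 + 2 * (S n ω * X n ω)) P :=
        (hSL2 n).integrable_sq.add (i1.const_mul 2)
      rw [integral_add i2 (hL2 n).integrable_sq,
        integral_add (hSL2 n).integrable_sq (i1.const_mul 2), integral_const_mul, horth]
      ring
  -- Orthogonality bounds the partial sums in `L²`; the elementary `|s| ≤ 1 + s²` converts this into
  -- the `L¹` bound required by submartingale convergence.
  set C : ℝ := 1 + ∑' k, ∫ ω, X k ω ^ 2 ∂P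
  refine hmart.submartingale.exists_ae_tendsto_of_bdd (R := C.toNNReal) fun n => ?_
  rw [eLpNorm_one_eq_lintegral_enorm, ← ofReal_integral_norm_eq_lintegral_enorm (hSint n)]
  refine ENNReal.ofReal_le_ofReal ?_
  calc ∫ ω, ‖S n ω‖ ∂P ≤ ∫ ω, (1 + S n ω ^ 2) ∂P := by
        refine integral_mono (hSint n).norm ((integrable_const 1).add (hSL2 n).integrable_sq)
          fun ω => ?_
        simp only [Real.norm_eq_abs]
        have := sq_nonneg (|S n ω| - 1)
        rw [← sq_abs (S n ω)]
        nlinarith [sq_nonneg |S n ω|]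
    _ = 1 + ∑ k ∈ Finset.range n, ∫ ω, X k ω ^ 2 ∂P := by
        rw [integral_add (integrable_const 1) (hSL2 n).integrable_sq, hvar]; simp
    _ ≤ C := by
        have := hs.sum_le_tsum (Finset.range n) (fun k _ => integral_nonneg fun ω => sq_nonneg _)
        linarith

/-- A series of vector-valued martingale differences with summable variances converges almost
surely. -/
lemma ae_exists_tendsto_sum [IsProbabilityMeasure P] {ℱ : Filtration ℕ mΩ} {d : ℕ}
    {X : ℕ → Ω → Vec d} (hmeas : ∀ n, StronglyMeasurable[ℱ (n + 1)] (X n))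
    (hL2 : ∀ n, Integrable (fun ω => ‖X n ω‖ ^ 2) P) (hcond : ∀ n, P[X n | ℱ n] =ᵐ[P] 0)
    (hs : Summable fun n => ∫ ω, ‖X n ω‖ ^ 2 ∂P) :
    ∀ᵐ ω ∂P, ∃ c, Tendsto (fun n => ∑ k ∈ Finset.range n, X k ω) atTop (𝓝 c) := by
  have hX2 : ∀ n, MemLp (X n) 2 P := fun n =>
    (memLp_two_iff_integrable_sq_norm ((hmeas n).mono (ℱ.le _)).aestronglyMeasurable).mpr (hL2 n)
  have hcoord : ∀ c : Fin d, ∀ᵐ ω ∂P, ∃ a,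
      Tendsto (fun n => ∑ k ∈ Finset.range n, X k ω c) atTop (𝓝 a) := by
    intro c
    have hle : ∀ n ω, X n ω c ^ 2 ≤ ‖X n ω‖ ^ 2 := fun n ω => by
      have := PiLp.norm_apply_le (X n ω) c
      rw [← sq_abs]
      exact pow_le_pow_left₀ (abs_nonneg _) this 2
    have hm : ∀ n, MemLp (fun ω => X n ω c) 2 P := fun n =>
      (EuclideanSpace.proj (𝕜 := ℝ) c).comp_memLp' (hX2 n)
    refine ae_exists_tendsto_sum_real (ℱ := ℱ)
      (fun n => (EuclideanSpace.proj (𝕜 := ℝ) c).continuous.comp_stronglyMeasurable (hmeas n))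
      hm (fun n => ?_) ?_
    · have h1 := (EuclideanSpace.proj (𝕜 := ℝ) c).comp_condExp_comm (m := ℱ n)
        ((hX2 n).integrable (by norm_num))
      filter_upwards [h1, hcond n] with ω h1 h2
      have h3 : (P[(fun ω => X n ω c) | ℱ n]) ω = (P[X n | ℱ n]) ω c := h1.symm
      rw [h3, h2]; rfl
    · exact Summable.of_nonneg_of_le (fun n => integral_nonneg fun ω => sq_nonneg _)
        (fun n => integral_mono (hm n).integrable_sq (hL2 n) (hle n)) hs
  filter_upwards [ae_all_iff.mpr hcoord] with ω hω
  choose a ha using hω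
  refine ⟨WithLp.toLp 2 a, ?_⟩
  rw [(PiLp.homeomorph 2 fun _ : Fin d => ℝ).isInducing.tendsto_nhds_iff, tendsto_pi_nhds]
  intro c
  refine (ha c).congr fun n => ?_
  simp [PiLp.homeomorph]

/-- The difference `K - P[X | m]` is `m`-measurable with nonnegative integral over every
`m`-measurable set. The hypothesis uses lower integrals so that integrability of `X` is a
conclusion. -/
lemma condExp_le_const_of_setLIntegral_le [IsProbabilityMeasure P]
    (hm : m ≤ mΩ) {X : Ω → ℝ} (hX : Measurable X) (h0 : ∀ ω, 0 ≤ X ω) {K : ℝ} (hK : 0 ≤ K)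
    (h : ∀ A, MeasurableSet[m] A → ∫⁻ ω in A, ENNReal.ofReal (X ω) ∂P ≤ ENNReal.ofReal K * P A) :
    Integrable X P ∧ P[X | m] ≤ᵐ[P] fun _ => K := by
  have hint : Integrable X P := by
    refine ⟨hX.aestronglyMeasurable, ?_⟩
    rw [hasFiniteIntegral_iff_ofReal (Eventually.of_forall h0)]
    have := h Set.univ MeasurableSet.univ
    rw [setLIntegral_univ, measure_univ, mul_one] at this
    exact this.trans_lt ENNReal.ofReal_lt_top
  refine ⟨hint, ?_⟩
  have hsm : StronglyMeasurable[m] fun ω => K - (P[X | m]) ω :=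
    stronglyMeasurable_const.sub stronglyMeasurable_condExp
  have hi : Integrable (fun ω => K - (P[X | m]) ω) P := (integrable_const K).sub integrable_condExp
  have key : 0 ≤ᵐ[P.trim hm] fun ω => K - (P[X | m]) ω := by
    refine ae_nonneg_of_forall_setIntegral_nonneg (hi.trim hm hsm) fun A hA _ => ?_
    rw [← setIntegral_trim hm hsm hA,
      integral_sub (integrable_const K).integrableOn integrable_condExp.integrableOn,
      setIntegral_condExp hm hint hA, setIntegral_const, sub_nonneg,
      integral_eq_lintegral_of_nonneg_ae (Eventually.of_forall h0) hX.aestronglyMeasurable]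
    refine ENNReal.toReal_le_of_le_ofReal (by positivity) ((h A hA).trans ?_)
    rw [smul_eq_mul, ENNReal.ofReal_mul (by positivity), measureReal_def,
      ENNReal.ofReal_toReal (measure_ne_top P A), mul_comm]
  filter_upwards [ae_of_ae_trim hm key] with ω hω
  have : 0 ≤ K - (P[X | m]) ω := hω
  linarith

/-- A variable independent of `m` and, conditionally on `m`, of `Z`, is independent of `m` and `Z`
jointly. -/
lemma CondIndepGiven.indep_sup [IsProbabilityMeasure P] {E F : Type*} [MeasurableSpace E]
    [MeasurableSpace F] (hm : m ≤ mΩ) {X : Ω → E} {Z : Ω → F}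
    (hX : Measurable X) (hZ : Measurable Z) (hci : CondIndepGiven P m X Z)
    (hind : Indep (MeasurableSpace.comap X inferInstance) m P) :
    Indep (MeasurableSpace.comap X inferInstance)
      (m ⊔ MeasurableSpace.comap Z inferInstance) P := by
  -- A π-system generating the joint σ-field, on which independence can be checked.
  set p : Set (Set Ω) := {s | ∃ C, MeasurableSet[m] C ∧ ∃ B, MeasurableSet B ∧ s = C ∩ Z ⁻¹' B}
  have hp : IsPiSystem p := by
    rintro _ ⟨C, hC, B, hB, rfl⟩ _ ⟨C', hC', B', hB', rfl⟩ -
    refine ⟨C ∩ C', hC.inter hC', B ∩ B', hB.inter hB', ?_⟩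
    ext ω; simp only [Set.mem_inter_iff, Set.mem_preimage]; tauto
  have hgen : m ⊔ MeasurableSpace.comap Z inferInstance = MeasurableSpace.generateFrom p := by
    refine le_antisymm (sup_le ?_ ?_) (MeasurableSpace.generateFrom_le ?_)
    · intro C hC
      exact MeasurableSpace.measurableSet_generateFrom ⟨C, hC, Set.univ, .univ, by simp⟩
    · rintro _ ⟨B, hB, rfl⟩
      exact MeasurableSpace.measurableSet_generateFrom
        ⟨Set.univ, MeasurableSet.univ, B, hB, by simp⟩
    · rintro _ ⟨C, hC, B, hB, rfl⟩
      have h1 : MeasurableSet[m ⊔ MeasurableSpace.comap Z inferInstance] C :=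
        (le_sup_left : m ≤ _) C hC
      have h2 : MeasurableSet[m ⊔ MeasurableSpace.comap Z inferInstance] (Z ⁻¹' B) :=
        (le_sup_right : MeasurableSpace.comap Z inferInstance ≤ _) _ ⟨B, hB, rfl⟩
      exact h1.inter h2
  have hXle : MeasurableSpace.comap X inferInstance ≤ mΩ := hX.comap_le
  refine IndepSets.indep hXle (sup_le hm hZ.comap_le)
    (@MeasurableSpace.isPiSystem_measurableSet Ω (MeasurableSpace.comap X inferInstance)) hp
    (@MeasurableSpace.generateFrom_measurableSet Ω (MeasurableSpace.comap X inferInstance)).symm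
    hgen ?_
  rw [IndepSets_iff]
  rintro _ _ ⟨A, hA, rfl⟩ ⟨C, hC, B, hB, rfl⟩
  have hXA := hX hA
  have hZB := hZ hB
  have i1 : ∀ {s : Set Ω}, MeasurableSet s → Integrable (s.indicator fun _ => (1 : ℝ)) P :=
    fun hs => (integrable_const 1).indicator hs
  have hset : ∀ {s : Set Ω}, MeasurableSet s → ∫ ω in C, (P⟦s | m⟧) ω ∂P = P.real (C ∩ s) := by
    intro s hs
    rw [setIntegral_condExp hm (i1 hs) hC, setIntegral_indicator hs, setIntegral_const]
    simp
  have hXc : P⟦X ⁻¹' A | m⟧ =ᵐ[P] fun _ => P.real (X ⁻¹' A) := by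
    have h1 := condExp_indep_eq (μ := P) (f := (X ⁻¹' A).indicator fun _ => (1 : ℝ)) hXle hm
      ((stronglyMeasurable_const).indicator ⟨A, hA, rfl⟩) hind
    refine h1.trans (Eventually.of_forall fun ω => ?_)
    simp only
    rw [integral_indicator hXA, setIntegral_const]; simp
  -- Integrate the conditional product formula over `C`; the factor for `X` is constant by
  -- independence from `m`.
  have key : P.real (C ∩ (X ⁻¹' A ∩ Z ⁻¹' B)) = P.real (X ⁻¹' A) * P.real (C ∩ Z ⁻¹' B) := by
    rw [← hset (hXA.inter hZB), ← hset hZB, ← integral_const_mul]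
    refine setIntegral_congr_ae (hm _ hC) ?_
    filter_upwards [hci A B hA hB, hXc] with ω h1 h2 _
    rw [h1, h2]
  have hfin : ∀ s, P s ≠ ⊤ := fun s => measure_ne_top P s
  rw [← ENNReal.toReal_eq_toReal_iff' (hfin _) (ENNReal.mul_ne_top (hfin _) (hfin _)),
    ENNReal.toReal_mul]
  have e : X ⁻¹' A ∩ (C ∩ Z ⁻¹' B) = C ∩ (X ⁻¹' A ∩ Z ⁻¹' B) := by
    ext ω; simp only [Set.mem_inter_iff]; tauto
  rw [e]
  exact key

end Probability

/-! ### Algebra of averaging and disagreement. -/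

section Network

variable {N d : ℕ}

/-- The squared distance of a network state to consensus. -/
def disagr (x : NetVec N d) : ℝ := ∑ i, ‖x i - netAvg x‖ ^ 2

lemma disagr_nonneg (x : NetVec N d) : 0 ≤ disagr x :=
  Finset.sum_nonneg fun _ _ => sq_nonneg _

lemma sum_sub_netAvg (hN : 1 ≤ N) (x : NetVec N d) : ∑ i, (x i - netAvg x) = 0 := by
  have hN0 : (N : ℝ) ≠ 0 := by positivity
  rw [Finset.sum_sub_distrib, Finset.sum_const, Finset.card_univ, Fintype.card_fin, netAvg,
    ← Nat.cast_smul_eq_nsmul ℝ, smul_smul, mul_one_div_cancel hN0, one_smul, sub_self]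

/-- The mean minimizes the sum of squared distances; the cross term vanishes after summation. -/
lemma disagr_le (hN : 1 ≤ N) (x : NetVec N d) (c : Vec d) : disagr x ≤ ∑ i, ‖x i - c‖ ^ 2 := by
  have e : ∀ i, ‖x i - c‖ ^ 2 = ‖x i - netAvg x‖ ^ 2 +
      2 * inner ℝ (x i - netAvg x) (netAvg x - c) + ‖netAvg x - c‖ ^ 2 := fun i => by
    rw [← norm_add_sq_real]; congr 2; abel
  simp_rw [e, Finset.sum_add_distrib, ← Finset.mul_sum, ← sum_inner, sum_sub_netAvg hN]
  rw [disagr, inner_zero_left]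
  have : 0 ≤ ∑ _i : Fin N, ‖netAvg x - c‖ ^ 2 := Finset.sum_nonneg fun _ _ => sq_nonneg _
  linarith

lemma netAvg_mem {G : Set (Vec d)} (hN : 1 ≤ N) (hG : Convex ℝ G) {x : NetVec N d}
    (hx : ∀ i, x i ∈ G) : netAvg x ∈ G := by
  have hN0 : (N : ℝ) ≠ 0 := by positivity
  rw [netAvg, Finset.smul_sum]
  exact hG.sum_mem (fun _ _ => by positivity) (by simp [hN0]) fun i _ => hx i

lemma disagreement_transpose : (disagreement N).transpose = disagreement N := by
  ext i j; simp [disagreement, Matrix.one_apply, eq_comm]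

lemma disagreement_mul_self (hN : 1 ≤ N) : disagreement N * disagreement N = disagreement N := by
  have hN0 : (N : ℝ) ≠ 0 := by positivity
  have h : (Matrix.of fun _ _ => (1 : ℝ) / N : Matrix (Fin N) (Fin N) ℝ) *
      (Matrix.of fun _ _ => (1 : ℝ) / N) = Matrix.of fun _ _ => (1 : ℝ) / N := by
    ext i j; simp [Matrix.mul_apply, hN0]
  rw [disagreement, sub_mul, mul_sub, mul_sub, h]
  simp

/-- With `J` the projection `disagreement N`, row-stochasticity makes `J w` kill constant vectors,
so the argument may be centred at its mean, and `(J w)ᵀ (J w) = wᵀ J w`. The right side is linear in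
`wᵀ J w`, ready for taking expectations. -/
lemma disagr_gossip (hN : 1 ≤ N) {w : Matrix (Fin N) (Fin N) ℝ} (hw : ∀ i, ∑ j, w i j = 1)
    (x : NetVec N d) :
    disagr (WithLp.toLp 2 fun i => ∑ j, w i j • x j : NetVec N d) =
      ∑ j, ∑ k, (w.transpose * disagreement N * w) j k *
        inner ℝ (x j - netAvg x) (x k - netAvg x) := by
  have hN0 : (N : ℝ) ≠ 0 := by positivity
  set B := disagreement N * w with hB
  have hQ : w.transpose * disagreement N * w = B.transpose * B := by
    rw [hB, Matrix.transpose_mul, disagreement_transpose, Matrix.mul_assoc, Matrix.mul_assoc,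
      ← Matrix.mul_assoc (disagreement N) (disagreement N), disagreement_mul_self hN]
  have hBe : ∀ i k, B i k = w i k - (1 / (N : ℝ)) * ∑ l, w l k := fun i k => by
    rw [hB, disagreement, sub_mul, one_mul, Matrix.sub_apply, Matrix.mul_apply, Finset.mul_sum]
    rfl
  have hB1 : ∀ i, ∑ k, B i k = 0 := fun i => by
    simp_rw [hBe, Finset.sum_sub_distrib, hw, ← Finset.mul_sum]
    rw [Finset.sum_comm]
    simp [hw, hN0]
  have hy : ∀ i, (∑ j, w i j • x j) -
      netAvg (WithLp.toLp 2 fun i => ∑ j, w i j • x j : NetVec N d) =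
      ∑ k, B i k • (x k - netAvg x) := fun i => by
    simp_rw [smul_sub, Finset.sum_sub_distrib, ← Finset.sum_smul, hB1, zero_smul, sub_zero, hBe,
      sub_smul, Finset.sum_sub_distrib, netAvg, mul_smul, ← Finset.smul_sum, Finset.sum_smul]
    rw [Finset.sum_comm]
  rw [disagr, hQ]
  have hsq : ∀ i, ‖∑ k, B i k • (x k - netAvg x)‖ ^ 2 =
      ∑ j, ∑ k, B i j * B i k * inner ℝ (x j - netAvg x) (x k - netAvg x) := fun i => by
    rw [← real_inner_self_eq_norm_sq, sum_inner]
    refine Finset.sum_congr rfl fun j _ => ?_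
    rw [inner_sum]
    refine Finset.sum_congr rfl fun k _ => ?_
    rw [real_inner_smul_left, real_inner_smul_right, mul_assoc]
  simp only [hy, hsq]
  rw [Finset.sum_comm]
  refine Finset.sum_congr rfl fun j _ => ?_
  rw [Finset.sum_comm]
  refine Finset.sum_congr rfl fun k _ => ?_
  rw [Matrix.mul_apply, Finset.sum_mul]
  rfl

/-- The quadratic form decouples over the `d` coordinates, each handled by the scalar operator norm
bound. -/
lemma sum_inner_le_spectralNorm (M : Matrix (Fin N) (Fin N) ℝ) (u : Fin N → Vec d) :
    ∑ j, ∑ k, M j k * inner ℝ (u j) (u k) ≤ matrixSpectralNorm M * ∑ j, ‖u j‖ ^ 2 := by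
  have hc : ∀ a : Fin N → ℝ, ∑ j, ∑ k, M j k * (a j * a k) ≤ matrixSpectralNorm M * ∑ j, a j ^ 2 := by
    intro a
    set v : EuclideanSpace ℝ (Fin N) := WithLp.toLp 2 a
    have h1 : inner ℝ v (Matrix.toEuclideanCLM (n := Fin N) (𝕜 := ℝ) M v) =
        ∑ j, ∑ k, M j k * (a j * a k) := by
      rw [PiLp.inner_apply]
      refine Finset.sum_congr rfl fun j _ => ?_
      rw [Matrix.ofLp_toEuclideanCLM]
      simp only [v, Matrix.mulVec, dotProduct, RCLike.inner_apply, conj_trivial, Finset.sum_mul]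
      refine Finset.sum_congr rfl fun k _ => by ring
    have h2 : ‖v‖ ^ 2 = ∑ j, a j ^ 2 := by
      rw [EuclideanSpace.norm_sq_eq]; simp [v]
    rw [← h1, ← h2, matrixSpectralNorm]
    have h3 := real_inner_le_norm v (Matrix.toEuclideanCLM (n := Fin N) (𝕜 := ℝ) M v)
    have h4 := (Matrix.toEuclideanCLM (n := Fin N) (𝕜 := ℝ) M).le_opNorm v
    have h5 := mul_le_mul_of_nonneg_left h4 (norm_nonneg v)
    nlinarith
  have e1 : ∑ j, ∑ k, M j k * inner ℝ (u j) (u k) =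
      ∑ c, ∑ j, ∑ k, M j k * (u j c * u k c) := by
    rw [Finset.sum_comm (s := (Finset.univ : Finset (Fin d)))]
    refine Finset.sum_congr rfl fun j _ => ?_
    rw [Finset.sum_comm (s := (Finset.univ : Finset (Fin d)))]
    refine Finset.sum_congr rfl fun k _ => ?_
    rw [PiLp.inner_apply, Finset.mul_sum]
    refine Finset.sum_congr rfl fun c _ => ?_
    simp only [RCLike.inner_apply, conj_trivial]; ring
  have e2 : ∑ j, ‖u j‖ ^ 2 = ∑ c, ∑ j, u j c ^ 2 := by
    rw [Finset.sum_comm (s := (Finset.univ : Finset (Fin d)))]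
    refine Finset.sum_congr rfl fun j _ => ?_
    rw [EuclideanSpace.norm_sq_eq]; simp
  rw [e1, e2, Finset.mul_sum]
  exact Finset.sum_le_sum fun c _ => hc fun j => u j c

end Network

/-! ### From almost sure estimates to convergence along one trajectory. -/

section Pathwise

variable {N d : ℕ}

lemma continuous_gradient {φ : Vec d → ℝ} (h : ContDiff ℝ 1 φ) : Continuous (gradient φ) :=
  (InnerProductSpace.toDual ℝ (Vec d)).symm.continuous.comp (h.continuous_fderiv (by norm_num))

lemma contDiff_avgUtility {f : Fin N → Vec d → ℝ} (hf : ∀ i, ContDiff ℝ 1 (f i)) :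
    ContDiff ℝ 1 (avgUtility f) :=
  contDiff_const.mul (ContDiff.sum fun i _ => hf i)

lemma gradient_avgUtility {f : Fin N → Vec d → ℝ} (hf : ∀ i, ContDiff ℝ 1 (f i)) (x : Vec d) :
    gradient (avgUtility f) x = (1 / (N : ℝ)) • ∑ i, gradient (f i) x := by
  have hd : ∀ i, HasFDerivAt (f i) (fderiv ℝ (f i) x) x := fun i =>
    ((hf i).differentiable (by norm_num) x).hasFDerivAt
  have h1 : HasFDerivAt (avgUtility f) ((1 / (N : ℝ)) • ∑ i, fderiv ℝ (f i) x) x :=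
    (HasFDerivAt.fun_sum fun i _ => hd i).const_mul (1 / (N : ℝ))
  rw [gradient, h1.fderiv, map_smul, map_sum]
  rfl

/-- The pathwise part of the argument: consensus, a convergent noise, and the approximate
variational inequalities of the agents imply the convergence to the KKT points. -/
theorem pathwise_convergence (hN : 1 ≤ N) {G : Set (Vec d)} (hGc : IsCompact G)
    (hGconv : Convex ℝ G) (hGne : G.Nonempty) {f : Fin N → Vec d → ℝ}
    (hf : ∀ i, ContDiff ℝ 1 (f i)) {θ : ℕ → NetVec N d} {H : ℕ → Fin N → Vec d} {γ : ℕ → ℝ}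
    {K M : ℝ} (hθ : ∀ n i, θ n i ∈ G) (hdis : Tendsto (fun n => disagr (θ n)) atTop (𝓝 0))
    (hpos : ∀ n, 0 < γ n) (hγ : Tendsto γ atTop (𝓝 0))
    (hsum : Tendsto (fun n => ∑ k ∈ Finset.range n, γ k) atTop atTop)
    (hM : 0 < M) (hH : ∀ n i, ‖H n i‖ ≤ M)
    (hvar : ∀ n i, ∀ y ∈ G, inner ℝ (H n i + gradient (f i) (θ n i)) (θ n i - y) ≤ 2 * γ n * K)
    (hnoise : ∃ c, Tendsto (fun n => ∑ k ∈ Finset.range n, (netAvg (θ (k + 1)) - netAvg (θ k) -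
      γ k • (1 / (N : ℝ)) • ∑ i, H k i)) atTop (𝓝 c))
    (hint : interior (avgUtility f '' kktSet G (avgUtility f)) = ∅) :
    ConvergesToSet θ (consensus N '' kktSet G (avgUtility f)) ∧
      ∃ a ∈ kktSet G (avgUtility f), ConvergesToSet (fun n => netAvg (θ n))
        (connectedComponentIn (kktSet G (avgUtility f)) a) := by
  have hN0 : (N : ℝ) ≠ 0 := by positivity
  set F := avgUtility f with hF
  have hFgrad : ∀ x, HasGradientAt F (gradient F x) x := fun x =>
    ((contDiff_avgUtility hf).differentiable (by norm_num) x).hasGradientAt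
  have hgc : Continuous (gradient F) := continuous_gradient (contDiff_avgUtility hf)
  set x : ℕ → Vec d := fun n => netAvg (θ n) with hx
  set h : ℕ → Vec d := fun n => (1 / (N : ℝ)) • ∑ i, H n i with hh
  set S : ℕ → Vec d := fun n => ∑ k ∈ Finset.range n, (x (k + 1) - x k - γ k • h k) with hS
  obtain ⟨c, hc⟩ := hnoise
  -- Removing the noise makes the increment of `z` exactly `γ n • h n`. The correction `c - S n`
  -- tends to zero, so `z` may leave `G` but approaches it.
  set z : ℕ → Vec d := fun n => x n - S n + c with hz
  have hxG : ∀ n, x n ∈ G := fun n => netAvg_mem hN hGconv (hθ n)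
  have hzx : Tendsto (fun n => z n - x n) atTop (𝓝 0) := by
    have h1 : Tendsto (fun n => c - S n) atTop (𝓝 (c - c)) := tendsto_const_nhds.sub hc
    rw [sub_self] at h1
    refine h1.congr fun n => ?_
    simp only [hz]; abel
  have hxθ : ∀ i, Tendsto (fun n => x n - θ n i) atTop (𝓝 0) := fun i => by
    have h1 := hdis.sqrt
    rw [Real.sqrt_zero] at h1
    refine squeeze_zero_norm (fun n => ?_) h1
    rw [norm_sub_rev]
    refine Real.le_sqrt_of_sq_le ?_
    exact Finset.single_le_sum (f := fun i => ‖θ n i - x n‖ ^ 2) (fun j _ => sq_nonneg _)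
      (Finset.mem_univ i)
  have hzθ : ∀ i, Tendsto (fun n => z n - θ n i) atTop (𝓝 0) := fun i => by
    have h1 := hzx.add (hxθ i)
    simpa using h1
  obtain ⟨R₀, hR₀⟩ := hGc.isBounded.exists_norm_le
  obtain ⟨R₁, hR₁⟩ := Metric.isBounded_range_of_tendsto _ hzx |>.exists_norm_le
  set R := R₀ + |R₁| with hR
  have hGR : ∀ y ∈ G, y ∈ Metric.closedBall (0 : Vec d) R := fun y hy => by
    have := hR₀ y hy
    rw [mem_closedBall_zero_iff]; have := abs_nonneg R₁; linarith
  have hzR : ∀ n, z n ∈ Metric.closedBall (0 : Vec d) R := fun n => by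
    rw [mem_closedBall_zero_iff]
    have h1 := hR₁ _ (Set.mem_range_self n)
    have h2 := hR₀ _ (hxG n)
    have h3 : z n = x n + (z n - x n) := by abel
    rw [h3]
    exact (norm_add_le _ _).trans (add_le_add h2 (h1.trans (le_abs_self _)))
  have hhM : ∀ n, ‖h n‖ ≤ M := fun n => by
    rw [hh]; simp only; rw [norm_smul, Real.norm_of_nonneg (by positivity), one_div_mul_eq_div,
      div_le_iff₀ (by positivity)]
    refine (norm_sum_le_of_le _ fun i _ => hH n i).trans ?_
    simp [mul_comm]
  have hgi : ∀ i, Tendsto (fun n => ‖gradient (f i) (z n) - gradient (f i) (θ n i)‖) atTop (𝓝 0) := by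
    intro i
    rw [Metric.tendsto_nhds]
    intro ε hε
    obtain ⟨η, hη, hω⟩ := exists_modulus (continuous_gradient (hf i)) R (half_pos hε)
    filter_upwards [Metric.tendsto_nhds.mp (hzθ i) η hη] with n hn
    rw [dist_zero_right] at hn ⊢
    rw [norm_norm]
    exact (hω _ (hzR n) _ (hGR _ (hθ n i)) hn.le).trans_lt (half_lt_self hε)
  have hB : ∀ i, ∃ B, ∀ y ∈ Metric.closedBall (0 : Vec d) R, ‖gradient (f i) y‖ ≤ B := fun i =>
    (exists_norm_bound (continuous_gradient (hf i)) R).imp fun B hB => hB.2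
  choose B hB using hB
  have flow : AsympProjectedFlow G (gradient F) γ z h M R :=
    { compact := hGc
      convex := hGconv
      nonempty := hGne
      pos := hpos
      tendsto_zero := hγ
      sum_infinite := hsum
      step := fun n => by
        simp only [hz, hS, Finset.sum_range_succ]; abel
      M_pos := hM
      bound := hhM
      mem_ball := hzR
      near := fun δ hδ => by
        filter_upwards [Metric.tendsto_nhds.mp hzx δ hδ] with n hn
        rw [dist_zero_right, ← dist_eq_norm] at hn
        exact Metric.mem_cthickening_of_dist_le _ _ _ _ (hxG n) hn.le
      variational := fun ε hε => by
        set e : ℕ → ℝ := fun n => (1 / (N : ℝ)) * ∑ i, (2 * γ n * K +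
          (‖gradient (f i) (z n) - gradient (f i) (θ n i)‖ * (2 * R) + (B i + M) * ‖z n - θ n i‖))
          with he
        have he0 : Tendsto e atTop (𝓝 0) := by
          have h1 : ∀ i ∈ Finset.univ, Tendsto (fun n => 2 * γ n * K +
              (‖gradient (f i) (z n) - gradient (f i) (θ n i)‖ * (2 * R) +
                (B i + M) * ‖z n - θ n i‖)) atTop (𝓝 (2 * 0 * K + (0 * (2 * R) + (B i + M) * 0))) :=
            fun i _ => ((hγ.const_mul 2).mul_const K).add (((hgi i).mul_const _).add
              ((by simpa using (hzθ i).norm : Tendsto (fun n => ‖z n - θ n i‖) atTop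
                (𝓝 0)).const_mul _))
          have h2 := (tendsto_finsetSum _ h1).const_mul (1 / (N : ℝ))
          simpa [he] using h2
        filter_upwards [he0.eventually_lt_const hε] with n hn y hy
        refine le_trans ?_ hn.le
        have h1 : gradient F (z n) + h n = (1 / (N : ℝ)) • ∑ i, (gradient (f i) (z n) + H n i) := by
          rw [hF, gradient_avgUtility hf, Finset.sum_add_distrib, smul_add]
        rw [h1, real_inner_smul_left, sum_inner, he]
        refine mul_le_mul_of_nonneg_left (Finset.sum_le_sum fun i _ => ?_) (by positivity)
        -- The agent's own inequality at `θ n i`, plus the errors of moving first the gradient and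
        -- then the base point to `z n`; both vanish by consensus and `hzx`.
        have h2 : inner ℝ (gradient (f i) (z n) + H n i) (z n - y) =
            inner ℝ (H n i + gradient (f i) (θ n i)) (θ n i - y) +
            (inner ℝ (gradient (f i) (z n) - gradient (f i) (θ n i)) (z n - y) +
              inner ℝ (gradient (f i) (θ n i) + H n i) (z n - θ n i)) := by
          simp only [inner_add_left, inner_sub_left, inner_sub_right]; ring
        rw [h2]
        refine add_le_add (hvar n i y hy) (add_le_add ?_ ?_)
        · refine (real_inner_le_norm _ _).trans (mul_le_mul_of_nonneg_left ?_ (norm_nonneg _))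
          have h3 := norm_sub_le (z n) y
          have h4 := mem_closedBall_zero_iff.mp (hzR n)
          have h5 := mem_closedBall_zero_iff.mp (hGR y hy)
          linarith
        · refine (real_inner_le_norm _ _).trans (mul_le_mul_of_nonneg_right ?_ (norm_nonneg _))
          exact (norm_add_le _ _).trans (add_le_add (hB i _ (hGR _ (hθ n i))) (hH n i)) }
  have hcluster : ∀ a, MapClusterPt a atTop x → a ∈ kktSet G F := by
    intro a ha
    obtain ⟨φ, hφ, hφa⟩ := ha.tendsto_subseq
    have h1 : Tendsto (z ∘ φ) atTop (𝓝 a) := by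
      have h2 := (hzx.comp hφ.tendsto_atTop).add hφa
      simpa [Function.comp_def] using h2
    -- `criticalSet` for `gradient F` unfolds to `kktSet`.
    exact flow.limit_mem_criticalSet hFgrad hgc hint hφ h1
  have hstep : Tendsto (fun n => dist (x (n + 1)) (x n)) atTop (𝓝 0) := by
    have h1 : Tendsto (fun n => (z (n + 1) - z n) - (z (n + 1) - x (n + 1)) + (z n - x n)) atTop
        (𝓝 (0 - 0 + 0)) :=
      (flow.tendsto_step.sub ((tendsto_add_atTop_iff_nat 1).mpr hzx)).add hzx
    rw [sub_zero, add_zero] at h1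
    have h2 := h1.norm
    rw [norm_zero] at h2
    refine h2.congr fun n => ?_
    rw [dist_eq_norm]; congr 1; abel
  have hxK : ∀ᶠ n in atTop, x n ∈ G := Eventually.of_forall hxG
  refine ⟨?_, exists_convergesToSet_connectedComponentIn hGc hxK hstep hcluster⟩
  have hcompact : IsCompact (prodSet N G) := by
    have h1 := (isCompact_univ_pi fun _ : Fin N => hGc).image
      (PiLp.continuous_toLp 2 fun _ : Fin N => Vec d)
    refine h1.of_isClosed_subset ?_ fun y hy => ⟨y.ofLp, fun i _ => hy i, rfl⟩
    rw [show prodSet N G = ⋂ i, (fun y : NetVec N d => y i) ⁻¹' G by ext; simp [prodSet]]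
    exact isClosed_iInter fun i => hGc.isClosed.preimage (by fun_prop)
  -- The states lie in the compact `G^N`, so it suffices to place their cluster points: all blocks
  -- share the limit of the averages, which is a KKT point.
  refine tendsto_of_tendsto_of_tendsto_of_le_of_le tendsto_const_nhds
    (convergesToSet_clusterPts hcompact (Eventually.of_forall hθ)) (fun _ => zero_le)
    (fun _ => Metric.infEDist_anti fun b hb => ?_)
  obtain ⟨φ, hφ, hφb⟩ := MapClusterPt.tendsto_subseq hb
  have hi : ∀ i, Tendsto (fun n => x (φ n)) atTop (𝓝 (b i)) := fun i => by
    have h1 : Tendsto (fun n => θ (φ n) i) atTop (𝓝 (b i)) :=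
      ((by fun_prop : Continuous fun y : NetVec N d => y i).tendsto b).comp hφb
    have h2 := ((hxθ i).comp hφ.tendsto_atTop).add h1
    simpa [Function.comp_def] using h2
  have i₀ : Fin N := ⟨0, hN⟩
  refine ⟨b i₀, hcluster _ ((hi i₀).mapClusterPt.of_comp hφ.tendsto_atTop), ?_⟩
  refine PiLp.ext fun i => ?_
  exact tendsto_nhds_unique (hi i₀) (hi i)

end Pathwise

/-! ### Moment bounds from a conditional law given event by event. -/

section ConditionalLaw

variable {Ω : Type*} {m mΩ : MeasurableSpace Ω} {P : Measure Ω}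

/-- If `κ` is the conditional law of `Z` given `m` (in the weak sense of one almost sure equality
for each event), then a bound on the integrals of `φ` under `κ` carries over to `φ ∘ Z`. -/
lemma setLIntegral_comp_le_of_condLaw [IsProbabilityMeasure P] {E : Type*} [MeasurableSpace E]
    (hm : m ≤ mΩ) {Z : Ω → E} (hZ : Measurable Z) {κ : Ω → Measure E}
    (hκ : ∀ ω, IsProbabilityMeasure (κ ω))
    (hlaw : ∀ B, MeasurableSet B → P⟦Z ⁻¹' B | m⟧ =ᵐ[P] fun ω => (κ ω).real B)
    {φ : E → ENNReal} (hφ : Measurable φ) {K : ENNReal}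
    (hK : ∀ᵐ ω ∂P, ∫⁻ y, φ y ∂(κ ω) ≤ K) {A : Set Ω} (hA : MeasurableSet[m] A) :
    ∫⁻ ω in A, φ (Z ω) ∂P ≤ K * P A := by
  have hAm : MeasurableSet A := hm _ hA
  have hκe : ∀ B ω, κ ω B = ENNReal.ofReal ((κ ω).real B) := fun B ω => by
    have := hκ ω
    rw [measureReal_def, ENNReal.ofReal_toReal (measure_ne_top _ _)]
  -- `κ` is not assumed to be a kernel; measurability for each fixed `B` is borrowed from the
  -- conditional probability. This suffices for simple functions, and monotone convergence is
  -- applied only to the integral of `φ ∘ Z`.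
  have hmeas : ∀ B, MeasurableSet B → AEMeasurable (fun ω => κ ω B) P := fun B hB => by
    simp_rw [hκe]
    exact ((stronglyMeasurable_condExp.mono hm).measurable.aemeasurable.congr
      (hlaw B hB)).ennreal_ofReal
  have hset : ∀ B, MeasurableSet B → P (A ∩ Z ⁻¹' B) = ∫⁻ ω in A, κ ω B ∂P := by
    intro B hB
    have hi : Integrable ((Z ⁻¹' B).indicator fun _ => (1 : ℝ)) P :=
      (integrable_const 1).indicator (hZ hB)
    have h1 : ∫ ω in A, (κ ω).real B ∂P = P.real (A ∩ Z ⁻¹' B) := by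
      have h2 := setIntegral_condExp hm hi hA
      rw [setIntegral_indicator (hZ hB), setIntegral_const] at h2
      rw [← setIntegral_congr_ae hAm ((hlaw B hB).mono fun ω hω _ => hω), h2]
      simp
    have hi2 : Integrable (fun ω => (κ ω).real B) P := integrable_condExp.congr (hlaw B hB)
    simp_rw [hκe]
    rw [← ofReal_integral_eq_lintegral_ofReal hi2.integrableOn
      (Eventually.of_forall fun ω => measureReal_nonneg), h1, measureReal_def,
      ENNReal.ofReal_toReal (measure_ne_top _ _)]
  have hsimple : ∀ s : SimpleFunc E ENNReal,
      ∫⁻ ω in A, s (Z ω) ∂P = ∫⁻ ω in A, ∫⁻ y, s y ∂(κ ω) ∂P := by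
    intro s
    rw [← lintegral_map s.measurable hZ, SimpleFunc.lintegral_eq_lintegral]
    simp_rw [SimpleFunc.lintegral_eq_lintegral, SimpleFunc.lintegral]
    rw [lintegral_finsetSum' _ fun x _ =>
      ((hmeas _ (s.measurableSet_fiber x)).const_mul x).restrict]
    refine Finset.sum_congr rfl fun x _ => ?_
    rw [lintegral_const_mul'' _ (hmeas _ (s.measurableSet_fiber x)).restrict,
      ← hset _ (s.measurableSet_fiber x), Measure.map_apply hZ (s.measurableSet_fiber x),
      Measure.restrict_apply (hZ (s.measurableSet_fiber x)), Set.inter_comm]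
  have hsup : ∀ ω, φ (Z ω) = ⨆ k, SimpleFunc.eapprox φ k (Z ω) := fun ω =>
    (SimpleFunc.iSup_eapprox_apply hφ (Z ω)).symm
  simp_rw [hsup]
  rw [lintegral_iSup (f := fun k ω => SimpleFunc.eapprox φ k (Z ω))
    (fun k => (SimpleFunc.measurable _).comp hZ)
    (fun i j hij ω => SimpleFunc.monotone_eapprox φ hij (Z ω))]
  refine iSup_le fun k => ?_
  rw [hsimple, ← setLIntegral_const]
  refine lintegral_mono_ae (ae_restrict_of_ae ?_)
  filter_upwards [hK] with ω hω
  refine (lintegral_mono fun y => ?_).trans hω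
  rw [← SimpleFunc.iSup_eapprox_apply hφ y]
  exact le_iSup (fun k => SimpleFunc.eapprox φ k y) k

end ConditionalLaw

/-! ### The projected local step. -/

section LocalStep

variable {N d : ℕ} {G : Set (Vec d)}

/-- The local projected step `θ̃_i = P_G[θ_i + γ y_i]`. -/
def localStep (G : Set (Vec d)) (γ : ℝ) (y θ : NetVec N d) : NetVec N d :=
  WithLp.toLp 2 fun j => proj G (θ j + γ • y j)

lemma localStep_mem (hne : G.Nonempty) (hcl : IsClosed G) (γ : ℝ) (y θ : NetVec N d) (i : Fin N) :
    localStep G γ y θ i ∈ G :=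
  (proj_spec hne hcl _).1

lemma norm_localStep_sub_le (hne : G.Nonempty) (hcl : IsClosed G) (hconv : Convex ℝ G) {γ : ℝ}
    (hγ : 0 ≤ γ) {y θ : NetVec N d} {i : Fin N} (hθ : θ i ∈ G) :
    ‖localStep G γ y θ i - θ i‖ ≤ γ * ‖y i‖ := by
  have h1 := norm_proj_sub_proj_le hne hcl hconv (θ i + γ • y i) (θ i)
  rwa [proj_eq_self hne hcl hθ, add_sub_cancel_left, norm_smul, Real.norm_of_nonneg hγ] at h1

/-- The direction `(θ̃_i - θ_i) / γ` in which the local projected step moves. -/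
def localDirection (G : Set (Vec d)) (γ : ℝ) (y θ : NetVec N d) (i : Fin N) : Vec d :=
  (1 / γ) • (localStep G γ y θ i - θ i)

lemma norm_localDirection_le (hne : G.Nonempty) (hcl : IsClosed G) (hconv : Convex ℝ G) {γ : ℝ}
    (hγ : 0 < γ) {y θ : NetVec N d} {i : Fin N} (hθ : θ i ∈ G) :
    ‖localDirection G γ y θ i‖ ≤ ‖y i‖ := by
  have h1 := norm_localStep_sub_le hne hcl hconv hγ.le (y := y) hθ
  rw [localDirection, norm_smul, Real.norm_of_nonneg (by positivity), one_div_mul_eq_div,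
    div_le_iff₀ hγ, mul_comm]
  exact h1

/-- Writing `t` for the projected point and `z` for the direction, `y i - z` is normal to `G` at
`t`. Hence the inequality holds with `0` when `θ i` is replaced by `t`, and that replacement costs
at most `2‖y i‖ · γ‖y i‖`. -/
lemma inner_localDirection_sub_le (hne : G.Nonempty) (hcl : IsClosed G) (hconv : Convex ℝ G)
    {γ : ℝ} (hγ : 0 < γ) {y θ : NetVec N d} {i : Fin N} (hθ : θ i ∈ G) {u : Vec d} (hu : u ∈ G) :
    inner ℝ (localDirection G γ y θ i - y i) (θ i - u) ≤ 2 * γ * ‖y i‖ ^ 2 := by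
  have h1 := inner_sub_proj_nonpos hne hcl hconv (θ i + γ • y i) hu
  have h2 := norm_localStep_sub_le hne hcl hconv hγ.le (y := y) hθ
  have h3 := norm_localDirection_le hne hcl hconv hγ (y := y) hθ
  change inner ℝ (θ i + γ • y i - localStep G γ y θ i) (u - localStep G γ y θ i) ≤ 0 at h1
  have hz : localStep G γ y θ i - θ i = γ • localDirection G γ y θ i := by
    rw [localDirection, smul_smul, mul_one_div_cancel hγ.ne', one_smul]
  set t := localStep G γ y θ i
  set z := localDirection G γ y θ i
  have h4 : θ i + γ • y i - t = γ • (y i - z) := by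
    rw [smul_sub, ← hz]; abel
  rw [h4, real_inner_smul_left] at h1
  have h5 : inner ℝ (y i - z) (u - t) ≤ 0 := by
    by_contra! hcon
    exact absurd h1 (not_le.mpr (mul_pos hγ hcon))
  have h6 : inner ℝ (z - y i) (θ i - u) = inner ℝ (y i - z) (u - t) +
      inner ℝ (z - y i) (θ i - t) := by
    simp only [inner_sub_left, inner_sub_right]; ring
  have h7 : inner ℝ (z - y i) (θ i - t) ≤ (2 * ‖y i‖) * (γ * ‖y i‖) := by
    refine (real_inner_le_norm _ _).trans (mul_le_mul ?_ ?_ (norm_nonneg _) (by positivity))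
    · exact (norm_sub_le _ _).trans (by linarith)
    · rw [norm_sub_rev]; exact h2
  rw [h6]; nlinarith

lemma measurable_localStep {Ω : Type*} {_ : MeasurableSpace Ω} (hne : G.Nonempty) (hcl : IsClosed G)
    (hconv : Convex ℝ G) (γ : ℝ) {y θ : Ω → NetVec N d} (hy : Measurable y) (hθ : Measurable θ) :
    Measurable fun ω => localStep G γ (y ω) (θ ω) := by
  have := (continuous_proj hne hcl hconv).measurable
  unfold localStep
  fun_prop

lemma measurable_gossip {Ω : Type*} {_ : MeasurableSpace Ω} {w : Ω → Matrix (Fin N) (Fin N) ℝ}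
    {x : Ω → NetVec N d} (hw : Measurable w) (hx : Measurable x) :
    Measurable fun ω => (WithLp.toLp 2 fun i => ∑ j, w ω i j • x ω j : NetVec N d) := by
  fun_prop

end LocalStep

/-! ### Measurability and first consequences of the model. -/

section Model

variable {Ω : Type*} {N d : ℕ} {G : Set (Vec d)} {γ : ℕ → ℝ}
  {W : ℕ → Ω → Matrix (Fin N) (Fin N) ℝ} {Y : ℕ → Ω → NetVec N d} {θ₀ : Ω → NetVec N d}

/-- The state of the network after the local step and before the gossip step `n + 1`. -/
def tentative (G : Set (Vec d)) (γ : ℕ → ℝ) (W : ℕ → Ω → Matrix (Fin N) (Fin N) ℝ)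
    (Y : ℕ → Ω → NetVec N d) (θ₀ : Ω → NetVec N d) (n : ℕ) (ω : Ω) : NetVec N d :=
  localStep G (γ (n + 1)) (Y (n + 1) ω) (iterate G γ W Y θ₀ n ω)

/-- The σ-field generated by the past `F_n` and the observation `Y_{n+1}`. -/
abbrev midField (W : ℕ → Ω → Matrix (Fin N) (Fin N) ℝ) (Y : ℕ → Ω → NetVec N d)
    (θ₀ : Ω → NetVec N d) (n : ℕ) : MeasurableSpace Ω :=
  pastField W Y θ₀ n ⊔ MeasurableSpace.comap (Y (n + 1)) inferInstance

lemma iterate_succ (n : ℕ) (ω : Ω) : iterate G γ W Y θ₀ (n + 1) ω =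
    WithLp.toLp 2 fun i => ∑ j, W (n + 1) ω i j • tentative G γ W Y θ₀ n ω j := rfl

lemma pastField_mono : Monotone (pastField W Y θ₀) := fun _ _ hab =>
  sup_le_sup_left (biSup_mono fun _ hk => Finset.Icc_subset_Icc_right hab hk) _

lemma measurable_Y_pastField (n : ℕ) : Measurable[pastField W Y θ₀ (n + 1)] (Y (n + 1)) :=
  (comap_measurable (Y (n + 1))).mono (le_trans (le_trans le_sup_left
    (le_iSup₂ (f := fun k (_ : k ∈ Finset.Icc 1 (n + 1)) =>
      MeasurableSpace.comap (Y k) inferInstance ⊔ MeasurableSpace.comap (W k) inferInstance)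
      (n + 1) (Finset.mem_Icc.mpr ⟨by omega, le_rfl⟩))) le_sup_right) le_rfl

lemma measurable_W_pastField (n : ℕ) : Measurable[pastField W Y θ₀ (n + 1)] (W (n + 1)) :=
  (comap_measurable (W (n + 1))).mono (le_trans (le_trans le_sup_right
    (le_iSup₂ (f := fun k (_ : k ∈ Finset.Icc 1 (n + 1)) =>
      MeasurableSpace.comap (Y k) inferInstance ⊔ MeasurableSpace.comap (W k) inferInstance)
      (n + 1) (Finset.mem_Icc.mpr ⟨by omega, le_rfl⟩))) le_sup_right) le_rfl

lemma measurable_iterate (hne : G.Nonempty) (hcl : IsClosed G) (hconv : Convex ℝ G) (n : ℕ) :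
    Measurable[pastField W Y θ₀ n] (iterate G γ W Y θ₀ n) := by
  induction n with
  | zero => exact (comap_measurable θ₀).mono le_sup_left le_rfl
  | succ n ih =>
    have hle : pastField W Y θ₀ n ≤ pastField W Y θ₀ (n + 1) := pastField_mono (by omega)
    exact measurable_gossip (measurable_W_pastField n) (measurable_localStep hne hcl hconv _
      (measurable_Y_pastField n) (ih.mono hle le_rfl))

lemma measurable_tentative (hne : G.Nonempty) (hcl : IsClosed G) (hconv : Convex ℝ G) (n : ℕ) :
    Measurable[midField W Y θ₀ n]
      (tentative G γ W Y θ₀ n) :=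
  measurable_localStep hne hcl hconv _ ((comap_measurable (Y (n + 1))).mono le_sup_right le_rfl)
    ((measurable_iterate hne hcl hconv n).mono le_sup_left le_rfl)

variable [mΩ : MeasurableSpace Ω] {P : Measure Ω} {f : Fin N → Vec d → ℝ}
  {μ : NetVec N d → Measure (NetVec N d)}

lemma ModelAssumption.pastField_le (hm : ModelAssumption P G f γ W Y θ₀ μ) (n : ℕ) :
    pastField W Y θ₀ n ≤ mΩ := by
  refine sup_le hm.measurable_init.comap_le (iSup₂_le fun k hk => ?_)
  have h1 := (Finset.mem_Icc.mp hk).1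
  exact sup_le (hm.measurable_Y k h1).comap_le (hm.measurable_W k h1).comap_le

lemma ModelAssumption.midField_le (hm : ModelAssumption P G f γ W Y θ₀ μ) (n : ℕ) :
    midField W Y θ₀ n ≤ mΩ :=
  sup_le (hm.pastField_le n) (hm.measurable_Y _ (by omega)).comap_le

/-- Each block is a convex combination of projected points. The initial state need not lie in `G`,
hence `1 ≤ n`. -/
lemma ModelAssumption.iterate_mem (hm : ModelAssumption P G f γ W Y θ₀ μ) (hne : G.Nonempty)
    (hcl : IsClosed G) (hconv : Convex ℝ G) (n : ℕ) (hn : 1 ≤ n) :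
    ∀ᵐ ω ∂P, ∀ i, iterate G γ W Y θ₀ n ω i ∈ G := by
  obtain ⟨n, rfl⟩ : ∃ k, n = k + 1 := ⟨n - 1, by omega⟩
  filter_upwards [hm.nonneg (n + 1) hn, hm.row_stochastic (n + 1) hn] with ω h1 h2 i
  exact hconv.sum_mem (fun j _ => h1 i j) (h2 i) fun j _ => localStep_mem hne hcl _ _ _ j

/-- The supremum of second moments over `G^N` applies because the iterates are almost surely in
`G^N`. -/
lemma ModelAssumption.exists_moment_bound [IsProbabilityMeasure P]
    (hm : ModelAssumption P G f γ W Y θ₀ μ)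
    (hne : G.Nonempty) (hcl : IsClosed G) (hconv : Convex ℝ G) :
    ∃ K ≥ 0, ∀ n, 1 ≤ n → Integrable (fun ω => ‖Y (n + 1) ω‖ ^ 2) P ∧
      P[fun ω => ‖Y (n + 1) ω‖ ^ 2 | pastField W Y θ₀ n] ≤ᵐ[P] fun _ => K := by
  set K := ⨆ x ∈ prodSet N G, ∫⁻ y, ‖y‖ₑ ^ 2 ∂(μ x) with hK
  have hKtop : K ≠ ⊤ := hm.second_moment.ne
  refine ⟨K.toReal, ENNReal.toReal_nonneg, fun n hn => ?_⟩
  have hY := hm.measurable_Y (n + 1) (by omega)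
  refine condExp_le_const_of_setLIntegral_le (hm.pastField_le n) (by fun_prop)
    (fun ω => by positivity) ENNReal.toReal_nonneg fun A hA => ?_
  rw [ENNReal.ofReal_toReal hKtop]
  have h1 : ∀ ω, ENNReal.ofReal (‖Y (n + 1) ω‖ ^ 2) = ‖Y (n + 1) ω‖ₑ ^ 2 := fun ω => by
    rw [ENNReal.ofReal_pow (norm_nonneg _), ofReal_norm]
  simp_rw [h1]
  refine setLIntegral_comp_le_of_condLaw (φ := fun y : NetVec N d => ‖y‖ₑ ^ 2)
    (κ := fun ω => μ (iterate G γ W Y θ₀ n ω)) (hm.pastField_le n) hY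
    (fun ω => hm.prob_law _) (hm.cond_law n hn) (by fun_prop) ?_ hA
  filter_upwards [hm.iterate_mem hne hcl hconv n hn] with ω hω
  exact le_iSup₂ (f := fun x (_ : x ∈ prodSet N G) => ∫⁻ y, ‖y‖ₑ ^ 2 ∂(μ x)) _ hω

lemma ModelAssumption.indep_sup [IsProbabilityMeasure P]
    (hm : ModelAssumption P G f γ W Y θ₀ μ) (n : ℕ) (hn : 1 ≤ n) :
    Indep (MeasurableSpace.comap (W (n + 1)) inferInstance)
      (midField W Y θ₀ n) P :=
  (hm.cond_indep n hn).indep_sup (hm.pastField_le n) (hm.measurable_W _ (by omega))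
    (hm.measurable_Y _ (by omega)) (hm.indep_past n hn)

end Model

/-! ### The random gossip step: mean preservation and contraction. -/

section Gossip

variable {Ω : Type*} {N d : ℕ} {G : Set (Vec d)} {γ : ℕ → ℝ}
  {W : ℕ → Ω → Matrix (Fin N) (Fin N) ℝ} {Y : ℕ → Ω → NetVec N d} {θ₀ : Ω → NetVec N d}
  [mΩ : MeasurableSpace Ω] {P : Measure Ω} {f : Fin N → Vec d → ℝ}
  {μ : NetVec N d → Measure (NetVec N d)}

lemma ModelAssumption.weight_mem_Icc (hm : ModelAssumption P G f γ W Y θ₀ μ) (n : ℕ) (hn : 1 ≤ n) :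
    ∀ᵐ ω ∂P, ∀ i j, W n ω i j ∈ Set.Icc (0 : ℝ) 1 := by
  filter_upwards [hm.nonneg n hn, hm.row_stochastic n hn] with ω h1 h2 i j
  refine ⟨h1 i j, ?_⟩
  rw [← h2 i]
  exact Finset.single_le_sum (fun k _ => h1 i k) (Finset.mem_univ j)

lemma ModelAssumption.integrable_weight [IsProbabilityMeasure P]
    (hm : ModelAssumption P G f γ W Y θ₀ μ) (n : ℕ) (hn : 1 ≤ n) (i j : Fin N) :
    Integrable (fun ω => W n ω i j) P := by
  have hW := hm.measurable_W n hn
  refine Integrable.of_bound (by fun_prop : Measurable fun ω => W n ω i j).aestronglyMeasurable 1 ?_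
  filter_upwards [hm.weight_mem_Icc n hn] with ω hω
  rw [Real.norm_of_nonneg (hω i j).1]; exact (hω i j).2

lemma netAvg_gossip (w : Matrix (Fin N) (Fin N) ℝ) (x : NetVec N d) :
    netAvg (WithLp.toLp 2 fun i => ∑ j, w i j • x j : NetVec N d) - netAvg x =
      ∑ j, ((1 / (N : ℝ)) * (∑ i, w i j - 1)) • x j := by
  simp only [netAvg, mul_smul, ← Finset.smul_sum, ← smul_sub, sub_smul, one_smul,
    Finset.sum_sub_distrib, Finset.sum_smul]
  rw [Finset.sum_comm]

/-- The gossip step preserves the network average in conditional expectation. -/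
lemma ModelAssumption.condExp_netAvg_gossip [IsProbabilityMeasure P]
    (hm : ModelAssumption P G f γ W Y θ₀ μ) (hG : IsCompact G) (hne : G.Nonempty)
    (hconv : Convex ℝ G) (n : ℕ) (hn : 1 ≤ n) :
    P[fun ω => netAvg (iterate G γ W Y θ₀ (n + 1) ω) - netAvg (tentative G γ W Y θ₀ n ω) |
      pastField W Y θ₀ n] =ᵐ[P] 0 := by
  have hcl := hG.isClosed
  obtain ⟨R, hR⟩ := hG.isBounded.exists_norm_le
  have hℋle := hm.midField_le n
  have hWm := hm.measurable_W (n + 1) (by omega)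
  have hTm := measurable_tentative (γ := γ) (W := W) (Y := Y) (θ₀ := θ₀) hne hcl hconv n
  have hTj : ∀ j, StronglyMeasurable[midField W Y θ₀ n] fun ω => tentative G γ W Y θ₀ n ω j := fun j =>
    ((by fun_prop : Measurable fun x : NetVec N d => x j).comp hTm).stronglyMeasurable
  set c : Fin N → Ω → ℝ := fun j ω => (1 / (N : ℝ)) * (∑ i, W (n + 1) ω i j - 1) with hc
  have hcW : ∀ j, ∃ φ : Matrix (Fin N) (Fin N) ℝ → ℝ, Measurable φ ∧ c j = φ ∘ W (n + 1) :=
    fun j => ⟨fun w => (1 / (N : ℝ)) * (∑ i, w i j - 1), by fun_prop, rfl⟩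
  have hcint : ∀ j, Integrable (c j) P := fun j =>
    ((integrable_finsetSum _ fun i _ => hm.integrable_weight (n + 1) (by omega) i j).sub
      (integrable_const 1)).const_mul _
  have hc0 : ∀ j, ∫ ω, c j ω ∂P = 0 := fun j => by
    have h1 := hm.col_stochastic_mean (n + 1) (by omega) j
    simp only [expMatrix, Matrix.of_apply] at h1
    simp only [hc]
    rw [integral_const_mul, integral_sub (integrable_finsetSum _ fun i _ =>
      hm.integrable_weight (n + 1) (by omega) i j) (integrable_const 1),
      integral_finsetSum _ fun i _ => hm.integrable_weight (n + 1) (by omega) i j, h1]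
    simp
  -- Conditioning on `Y (n + 1)` as well makes the tentative state known while the weights remain
  -- independent; the tower property then returns to the past.
  have hcℋ : ∀ j, P[c j | midField W Y θ₀ n] =ᵐ[P] 0 := fun j => by
    obtain ⟨φ, hφ, he⟩ := hcW j
    have h1 := condExp_indep_eq (μ := P) (f := c j) hWm.comap_le hℋle
      (by rw [he]; exact (hφ.comp (comap_measurable (W (n + 1)))).stronglyMeasurable)
      (hm.indep_sup n hn)
    rw [hc0 j] at h1
    exact h1
  have hprod : ∀ j, Integrable (c j • fun ω => tentative G γ W Y θ₀ n ω j) P := fun j =>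
    (hcint j).smul_bdd R ((hTj j).mono hℋle).aestronglyMeasurable
      (Eventually.of_forall fun ω => hR _ (localStep_mem hne hcl _ _ _ j))
  have hterm : ∀ j, P[c j • fun ω => tentative G γ W Y θ₀ n ω j | midField W Y θ₀ n] =ᵐ[P] 0 := fun j => by
    refine (condExp_smul_of_aestronglyMeasurable_right (hcint j) (hprod j)
      (hTj j).aestronglyMeasurable).trans ?_
    filter_upwards [hcℋ j] with ω hω
    simp [hω]
  have he : (fun ω => netAvg (iterate G γ W Y θ₀ (n + 1) ω) - netAvg (tentative G γ W Y θ₀ n ω)) =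
      ∑ j, c j • fun ω => tentative G γ W Y θ₀ n ω j := by
    ext1 ω
    rw [iterate_succ, netAvg_gossip]
    simp [hc]
  have hsum : P[∑ j, c j • fun ω => tentative G γ W Y θ₀ n ω j | midField W Y θ₀ n] =ᵐ[P] 0 := by
    refine (condExp_finsetSum (fun j _ => hprod j) _).trans ?_
    filter_upwards [ae_all_iff.mpr hterm] with ω hω
    simp [Finset.sum_apply, hω]
  rw [he]
  refine (condExp_condExp_of_le (le_sup_left : pastField W Y θ₀ n ≤ midField W Y θ₀ n) hℋle).symm.trans ?_
  refine (condExp_congr_ae hsum).trans ?_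
  rw [condExp_zero]

lemma ModelAssumption.indepFun_weight [IsProbabilityMeasure P]
    (hm : ModelAssumption P G f γ W Y θ₀ μ) (n : ℕ) (hn : 1 ≤ n)
    {φ : Matrix (Fin N) (Fin N) ℝ → ℝ} (hφ : Measurable φ) {X : Ω → ℝ}
    (hX : Measurable[midField W Y θ₀ n] X) :
    IndepFun (fun ω => φ (W (n + 1) ω)) X P := by
  rw [IndepFun_iff_Indep]
  exact indep_of_indep_of_le_left (indep_of_indep_of_le_right (hm.indep_sup n hn) hX.comap_le)
    (hφ.comp (comap_measurable (W (n + 1)))).comap_le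

/-- The gossip step contracts the mean square disagreement by the factor `ρ`. -/
lemma ModelAssumption.integral_disagr_gossip_le [IsProbabilityMeasure P]
    (hm : ModelAssumption P G f γ W Y θ₀ μ) (hN : 1 ≤ N) (hG : IsCompact G) (hne : G.Nonempty)
    (hconv : Convex ℝ G) (n : ℕ) (hn : 1 ≤ n) :
    ∫ ω, disagr (iterate G γ W Y θ₀ (n + 1) ω) ∂P ≤
      rho P (W (n + 1)) * ∫ ω, disagr (tentative G γ W Y θ₀ n ω) ∂P := by
  have hcl := hG.isClosed
  have hℋle := hm.midField_le n
  obtain ⟨R, hR⟩ := hG.isBounded.exists_norm_le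
  have hWm := hm.measurable_W (n + 1) (by omega)
  have hTm := measurable_tentative (γ := γ) (W := W) (Y := Y) (θ₀ := θ₀) hne hcl hconv n
  set T := tentative G γ W Y θ₀ n with hT
  have hTG : ∀ ω j, T ω j ∈ G := fun ω j => localStep_mem hne hcl _ _ _ j
  set Q : Fin N → Fin N → Matrix (Fin N) (Fin N) ℝ → ℝ := fun j k w =>
    (w.transpose * disagreement N * w) j k with hQ
  have hQm : ∀ j k, Measurable (Q j k) := fun j k => by
    simp only [hQ, Matrix.mul_apply, Matrix.transpose_apply]; fun_prop
  have hQint : ∀ j k, Integrable (fun ω => Q j k (W (n + 1) ω)) P := fun j k => by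
    refine Integrable.of_bound ((hQm j k).comp hWm).aestronglyMeasurable
      (∑ l, ∑ i, |disagreement N i l|) ?_
    filter_upwards [hm.weight_mem_Icc (n + 1) (by omega)] with ω hω
    simp only [hQ, Matrix.mul_apply, Matrix.transpose_apply]
    refine norm_sum_le_of_le _ fun l _ => ?_
    rw [Finset.sum_mul]
    refine norm_sum_le_of_le _ fun i _ => ?_
    have h1 := hω i j
    have h2 := hω l k
    rw [norm_mul, norm_mul, Real.norm_of_nonneg h1.1, Real.norm_of_nonneg h2.1, Real.norm_eq_abs]
    have h3 := abs_nonneg (disagreement N i l)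
    calc _ ≤ 1 * |disagreement N i l| * 1 := by
          gcongr
          · exact h2.1
          · exact h1.2
          · exact h2.2
      _ = _ := by ring
  set u : Ω → Fin N → Vec d := fun ω j => T ω j - netAvg (T ω) with hu
  have hub : ∀ ω j, ‖u ω j‖ ≤ 2 * R := fun ω j => by
    have h1 := hR _ (hTG ω j)
    have h2 := hR _ (netAvg_mem hN hconv (hTG ω))
    exact (norm_sub_le _ _).trans (by linarith)
  have hφm : ∀ j k, Measurable fun x : NetVec N d => inner ℝ (x j - netAvg x) (x k - netAvg x) :=
    fun j k => by unfold netAvg; fun_prop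
  have hIm : ∀ j k, Measurable[midField W Y θ₀ n] fun ω => inner ℝ (u ω j) (u ω k) := fun j k =>
    (hφm j k).comp hTm
  have hIb : ∀ j k ω, ‖inner ℝ (u ω j) (u ω k)‖ ≤ 2 * R * (2 * R) := fun j k ω =>
    (norm_inner_le_norm _ _).trans (mul_le_mul (hub ω j) (hub ω k) (norm_nonneg _)
      ((norm_nonneg _).trans (hub ω j)))
  have hIsm : ∀ j k, AEStronglyMeasurable (fun ω => inner ℝ (u ω j) (u ω k)) P := fun j k =>
    ((hIm j k).mono hℋle le_rfl).aestronglyMeasurable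
  have hIint : ∀ j k, Integrable (fun ω => inner ℝ (u ω j) (u ω k)) P := fun j k =>
    Integrable.of_bound (hIsm j k) _ (Eventually.of_forall (hIb j k))
  have hprod : ∀ j k, Integrable (fun ω => Q j k (W (n + 1) ω) * inner ℝ (u ω j) (u ω k)) P :=
    fun j k => (hQint j k).mul_bdd (c := 2 * R * (2 * R)) (hIsm j k)
      (Eventually.of_forall (hIb j k))
  set M := expMatrix P fun ω => (W (n + 1) ω).transpose * disagreement N * W (n + 1) ω with hM
  have hMe : ∀ j k, M j k = ∫ ω, Q j k (W (n + 1) ω) ∂P := fun j k => rfl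
  have hMint : ∀ j k, Integrable (fun ω => M j k * inner ℝ (u ω j) (u ω k)) P := fun j k =>
    (hIint j k).const_mul (M j k)
  clear_value M
  have h1 : ∫ ω, disagr (iterate G γ W Y θ₀ (n + 1) ω) ∂P =
      ∫ ω, ∑ j, ∑ k, Q j k (W (n + 1) ω) * inner ℝ (u ω j) (u ω k) ∂P := by
    refine integral_congr_ae ?_
    filter_upwards [hm.row_stochastic (n + 1) (by omega)] with ω hω
    rw [iterate_succ, disagr_gossip hN hω]
  -- Each matrix entry is independent of the tentative state, so it may be replaced by its mean;
  -- only then is the norm taken, which yields `rho`.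
  have h2 : ∫ ω, ∑ j, ∑ k, Q j k (W (n + 1) ω) * inner ℝ (u ω j) (u ω k) ∂P =
      ∫ ω, ∑ j, ∑ k, M j k * inner ℝ (u ω j) (u ω k) ∂P := by
    rw [integral_finsetSum _ fun j _ => integrable_finsetSum _ fun k _ => hprod j k,
      integral_finsetSum _ fun j _ => integrable_finsetSum _ fun k _ => hMint j k]
    refine Finset.sum_congr rfl fun j _ => ?_
    rw [integral_finsetSum _ fun k _ => hprod j k,
      integral_finsetSum _ fun k _ => hMint j k]
    refine Finset.sum_congr rfl fun k _ => ?_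
    rw [integral_const_mul, hMe]
    exact (hm.indepFun_weight n hn (hQm j k) (hIm j k)).integral_fun_mul_eq_mul_integral
      ((hQm j k).comp hWm).aestronglyMeasurable (hIsm j k)
  rw [h1, h2, ← integral_const_mul]
  refine integral_mono (integrable_finsetSum _ fun j _ => integrable_finsetSum _ fun k _ =>
    hMint j k) (Integrable.const_mul ?_ _) fun ω => ?_
  · have h3 := integrable_finsetSum Finset.univ fun j (_ : j ∈ Finset.univ) => hIint j j
    simp only [real_inner_self_eq_norm_sq] at h3
    exact h3
  · change _ ≤ rho P (W (n + 1)) * ∑ j, ‖u ω j‖ ^ 2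
    rw [rho, ← hM]
    exact sum_inner_le_spectralNorm M (u ω)

lemma ModelAssumption.integrable_disagr [IsProbabilityMeasure P]
    (hm : ModelAssumption P G f γ W Y θ₀ μ) (hN : 1 ≤ N) (hG : IsCompact G) (hne : G.Nonempty)
    (hconv : Convex ℝ G) (n : ℕ) (hn : 1 ≤ n) :
    Integrable (fun ω => disagr (iterate G γ W Y θ₀ n ω)) P := by
  obtain ⟨R, hR⟩ := hG.isBounded.exists_norm_le
  have hθm := (measurable_iterate (γ := γ) (W := W) (Y := Y) (θ₀ := θ₀) hne hG.isClosed hconv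
    n).mono (hm.pastField_le n) le_rfl
  have hφm : Measurable (disagr : NetVec N d → ℝ) := by
    unfold disagr netAvg; fun_prop
  refine Integrable.of_bound (hφm.comp hθm).aestronglyMeasurable (∑ _i : Fin N, (2 * R) ^ 2) ?_
  filter_upwards [hm.iterate_mem hne hG.isClosed hconv n hn] with ω hω
  rw [Real.norm_of_nonneg (disagr_nonneg _)]
  refine Finset.sum_le_sum fun i _ => pow_le_pow_left₀ (norm_nonneg _) ?_ 2
  have h1 := hR _ (hω i)
  have h2 := hR _ (netAvg_mem hN hconv hω)
  exact (norm_sub_le _ _).trans (by linarith)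

/-- Measure spread around the old average, then use `(a + b)² ≤ (1 + η)a² + (1 + 1/η)b²`, whose
defect is `(ηa - b)²/η`. -/
lemma disagr_localStep_le (hN : 1 ≤ N) (hcl : IsClosed G) (hne : G.Nonempty) (hconv : Convex ℝ G)
    {c η : ℝ} (hc : 0 ≤ c) (hη : 0 < η) (y : NetVec N d) {θ : NetVec N d} (hθ : ∀ i, θ i ∈ G) :
    disagr (localStep G c y θ) ≤ (1 + η) * disagr θ + (1 + 1 / η) * (c ^ 2 * ‖y‖ ^ 2) := by
  refine (disagr_le hN _ (netAvg θ)).trans ?_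
  rw [disagr, PiLp.norm_sq_eq_of_L2, Finset.mul_sum, Finset.mul_sum, Finset.mul_sum,
    ← Finset.sum_add_distrib]
  refine Finset.sum_le_sum fun i _ => ?_
  have h1 := norm_localStep_sub_le hne hcl hconv hc (y := y) (hθ i)
  have h2 : ‖localStep G c y θ i - netAvg θ‖ ≤ ‖θ i - netAvg θ‖ + c * ‖y i‖ := by
    have e : localStep G c y θ i - netAvg θ = (θ i - netAvg θ) + (localStep G c y θ i - θ i) := by
      abel
    rw [e]; exact (norm_add_le _ _).trans (by linarith)
  set a := ‖θ i - netAvg θ‖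
  set b := c * ‖y i‖ with hb
  have h3 : ‖localStep G c y θ i - netAvg θ‖ ^ 2 ≤ (a + b) ^ 2 :=
    pow_le_pow_left₀ (norm_nonneg _) h2 2
  have h4 : (1 + η) * a ^ 2 + (1 + 1 / η) * b ^ 2 - (a + b) ^ 2 = (η * a - b) ^ 2 / η := by
    field_simp; ring
  have h5 : 0 ≤ (η * a - b) ^ 2 / η := by positivity
  rw [← mul_pow]
  linarith

lemma ModelAssumption.disagr_recursion [IsProbabilityMeasure P]
    (hm : ModelAssumption P G f γ W Y θ₀ μ) (hN : 1 ≤ N) (hG : IsCompact G) (hne : G.Nonempty)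
    (hconv : Convex ℝ G) {K : ℝ} {n : ℕ} (hn : 1 ≤ n) (hγ : 0 ≤ γ (n + 1))
    (hYint : Integrable (fun ω => ‖Y (n + 1) ω‖ ^ 2) P)
    (hK : P[fun ω => ‖Y (n + 1) ω‖ ^ 2 | pastField W Y θ₀ n] ≤ᵐ[P] fun _ => K)
    {η : ℝ} (hη : 0 < η) :
    ∫ ω, disagr (iterate G γ W Y θ₀ (n + 1) ω) ∂P ≤ rho P (W (n + 1)) *
      ((1 + η) * ∫ ω, disagr (iterate G γ W Y θ₀ n ω) ∂P +
        (1 + 1 / η) * (γ (n + 1) ^ 2 * K)) := by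
  refine (hm.integral_disagr_gossip_le hN hG hne hconv n hn).trans
    (mul_le_mul_of_nonneg_left ?_ (norm_nonneg _))
  have hYK : ∫ ω, ‖Y (n + 1) ω‖ ^ 2 ∂P ≤ K := by
    rw [← integral_condExp (hm.pastField_le n)]
    refine (integral_mono_ae integrable_condExp (integrable_const K) hK).trans (by simp)
  have hint := hm.integrable_disagr hN hG hne hconv n hn
  have h1 : ∫ ω, disagr (tentative G γ W Y θ₀ n ω) ∂P ≤
      ∫ ω, ((1 + η) * disagr (iterate G γ W Y θ₀ n ω) +
        (1 + 1 / η) * (γ (n + 1) ^ 2 * ‖Y (n + 1) ω‖ ^ 2)) ∂P := by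
    refine integral_mono_of_nonneg (Eventually.of_forall fun ω => disagr_nonneg _)
      ((hint.const_mul _).add ((hYint.const_mul _).const_mul _)) ?_
    filter_upwards [hm.iterate_mem hne hG.isClosed hconv n hn] with ω hω
    exact disagr_localStep_le hN hG.isClosed hne hconv hγ hη _ hω
  rw [integral_add (hint.const_mul _) ((hYint.const_mul _).const_mul _), integral_const_mul,
    integral_const_mul, integral_const_mul] at h1
  refine h1.trans ?_
  gcongr

end Gossip

/-! ### Mean direction and martingale noise of the network average. -/

section MeanField

variable {Ω : Type*} {N d : ℕ} {G : Set (Vec d)} {γ : ℕ → ℝ}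
  {W : ℕ → Ω → Matrix (Fin N) (Fin N) ℝ} {Y : ℕ → Ω → NetVec N d} {θ₀ : Ω → NetVec N d}
  [mΩ : MeasurableSpace Ω] {P : Measure Ω} {f : Fin N → Vec d → ℝ}
  {μ : NetVec N d → Measure (NetVec N d)}

/-- The direction `(θ̃_{n+1,i} - θ_{n,i}) / γ_{n+1}` of the local step of agent `i`. -/
def stepDirection (G : Set (Vec d)) (γ : ℕ → ℝ) (W : ℕ → Ω → Matrix (Fin N) (Fin N) ℝ)
    (Y : ℕ → Ω → NetVec N d) (θ₀ : Ω → NetVec N d) (n : ℕ) (i : Fin N) (ω : Ω) : Vec d :=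
  localDirection G (γ (n + 1)) (Y (n + 1) ω) (iterate G γ W Y θ₀ n ω) i

/-- The conditional expectation given the past of the direction of the local step of agent `i`. -/
def meanDirection (P : Measure Ω) (G : Set (Vec d)) (γ : ℕ → ℝ)
    (W : ℕ → Ω → Matrix (Fin N) (Fin N) ℝ) (Y : ℕ → Ω → NetVec N d) (θ₀ : Ω → NetVec N d)
    (n : ℕ) (i : Fin N) : Ω → Vec d :=
  P[stepDirection G γ W Y θ₀ n i | pastField W Y θ₀ n]

/-- The part of the increment of the network average that is not predicted by the past. -/
def averageNoise (P : Measure Ω) (G : Set (Vec d)) (γ : ℕ → ℝ)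
    (W : ℕ → Ω → Matrix (Fin N) (Fin N) ℝ) (Y : ℕ → Ω → NetVec N d) (θ₀ : Ω → NetVec N d)
    (n : ℕ) (ω : Ω) : Vec d :=
  netAvg (iterate G γ W Y θ₀ (n + 1) ω) - netAvg (iterate G γ W Y θ₀ n ω) -
    γ (n + 1) • (1 / (N : ℝ)) • ∑ i, meanDirection P G γ W Y θ₀ n i ω

lemma ModelAssumption.measurable_stepDirection (hm : ModelAssumption P G f γ W Y θ₀ μ)
    (hne : G.Nonempty) (hcl : IsClosed G) (hconv : Convex ℝ G) (n : ℕ) (i : Fin N) :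
    Measurable (stepDirection G γ W Y θ₀ n i) := by
  have h1 : Measurable (tentative G γ W Y θ₀ n) :=
    (measurable_tentative hne hcl hconv n).mono (hm.midField_le n) le_rfl
  have h2 : Measurable (iterate G γ W Y θ₀ n) :=
    (measurable_iterate hne hcl hconv n).mono (hm.pastField_le n) le_rfl
  have h3 : Measurable fun x : NetVec N d => x i := by fun_prop
  exact ((h3.comp h1).sub (h3.comp h2)).const_smul (1 / γ (n + 1))

lemma norm_apply_le_one_add_sq (y : NetVec N d) (i : Fin N) : ‖y i‖ ≤ 1 + ‖y‖ ^ 2 := by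
  have h1 := PiLp.norm_apply_le y i
  nlinarith [sq_nonneg (‖y‖ - 1), sq_nonneg ‖y‖]

lemma ModelAssumption.norm_stepDirection_le (hm : ModelAssumption P G f γ W Y θ₀ μ)
    (hne : G.Nonempty) (hcl : IsClosed G) (hconv : Convex ℝ G) {n : ℕ} (hn : 1 ≤ n)
    (hγ : 0 < γ (n + 1)) (i : Fin N) :
    ∀ᵐ ω ∂P, ‖stepDirection G γ W Y θ₀ n i ω‖ ≤ 1 + ‖Y (n + 1) ω‖ ^ 2 := by
  filter_upwards [hm.iterate_mem hne hcl hconv n hn] with ω hω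
  exact (norm_localDirection_le hne hcl hconv hγ (hω i)).trans (norm_apply_le_one_add_sq _ i)

lemma ModelAssumption.integrable_stepDirection [IsProbabilityMeasure P]
    (hm : ModelAssumption P G f γ W Y θ₀ μ)
    (hne : G.Nonempty) (hcl : IsClosed G) (hconv : Convex ℝ G) {n : ℕ} (hn : 1 ≤ n)
    (hγ : 0 < γ (n + 1)) (hYint : Integrable (fun ω => ‖Y (n + 1) ω‖ ^ 2) P) (i : Fin N) :
    Integrable (stepDirection G γ W Y θ₀ n i) P :=
  ((integrable_const (1 : ℝ)).add hYint).mono'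
    (hm.measurable_stepDirection hne hcl hconv n i).aestronglyMeasurable
    (hm.norm_stepDirection_le hne hcl hconv hn hγ i)

lemma ModelAssumption.norm_meanDirection_le [IsProbabilityMeasure P]
    (hm : ModelAssumption P G f γ W Y θ₀ μ)
    (hne : G.Nonempty) (hcl : IsClosed G) (hconv : Convex ℝ G) {n : ℕ} (hn : 1 ≤ n)
    (hγ : 0 < γ (n + 1)) {K : ℝ} (hYint : Integrable (fun ω => ‖Y (n + 1) ω‖ ^ 2) P)
    (hK : P[fun ω => ‖Y (n + 1) ω‖ ^ 2 | pastField W Y θ₀ n] ≤ᵐ[P] fun _ => K) :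
    ∀ᵐ ω ∂P, ∀ i, ‖meanDirection P G γ W Y θ₀ n i ω‖ ≤ 1 + K := by
  refine ae_all_iff.mpr fun i => ?_
  have h1 := norm_condExp_le (μ := P) (m := pastField W Y θ₀ n) (stepDirection G γ W Y θ₀ n i)
  have h2 := condExp_mono (m := pastField W Y θ₀ n)
    (hm.integrable_stepDirection hne hcl hconv hn hγ hYint i).norm
    ((integrable_const (1 : ℝ)).add hYint) (hm.norm_stepDirection_le hne hcl hconv hn hγ i)
  have h3 := condExp_add (integrable_const (μ := P) (1 : ℝ)) hYint (pastField W Y θ₀ n)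
  rw [condExp_const (hm.pastField_le n)] at h3
  filter_upwards [h1, h2, h3, hK] with ω a1 a2 a3 a4
  refine a1.trans (a2.trans ?_)
  refine a3.le.trans ?_
  rw [Pi.add_apply]
  linarith

/-- For fixed `y` the bound for one local step is linear in the direction and in `Y`, and `θ_n` is
known, so conditional expectation passes through and turns `Y` into minus the gradients. -/
lemma ModelAssumption.meanDirection_variational [IsProbabilityMeasure P]
    (hm : ModelAssumption P G f γ W Y θ₀ μ) (hG : IsCompact G)
    (hne : G.Nonempty) (hconv : Convex ℝ G) {n : ℕ} (hn : 1 ≤ n)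
    (hγ : 0 < γ (n + 1)) {K : ℝ} (hYint : Integrable (fun ω => ‖Y (n + 1) ω‖ ^ 2) P)
    (hK : P[fun ω => ‖Y (n + 1) ω‖ ^ 2 | pastField W Y θ₀ n] ≤ᵐ[P] fun _ => K) :
    ∀ᵐ ω ∂P, ∀ i, ∀ y ∈ G, inner ℝ (meanDirection P G γ W Y θ₀ n i ω +
      gradient (f i) (iterate G γ W Y θ₀ n ω i)) (iterate G γ W Y θ₀ n ω i - y) ≤
        2 * γ (n + 1) * K := by
  have hcl := hG.isClosed
  obtain ⟨R, hR⟩ := hG.isBounded.exists_norm_le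
  refine ae_all_iff.mpr fun i => ?_
  have hYm := hm.measurable_Y (n + 1) (by omega)
  have hZint := hm.integrable_stepDirection hne hcl hconv hn hγ hYint i
  have hYi : Integrable (Y (n + 1)) P := by
    refine (memLp_two_iff_integrable_sq_norm hYm.aestronglyMeasurable).mpr hYint |>.integrable ?_
    norm_num
  set π : NetVec N d →L[ℝ] Vec d := PiLp.proj 2 (fun _ : Fin N => Vec d) i
  have hYii : Integrable (fun ω => Y (n + 1) ω i) P := π.integrable_comp hYi
  have hYcond : P[fun ω => Y (n + 1) ω i | pastField W Y θ₀ n] =ᵐ[P]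
      fun ω => -gradient (f i) (iterate G γ W Y θ₀ n ω i) := by
    have h1 := π.comp_condExp_comm (m := pastField W Y θ₀ n) hYi
    filter_upwards [h1, hm.cond_mean n hn] with ω a1 a2
    have a3 : (P[fun ω => Y (n + 1) ω i | pastField W Y θ₀ n]) ω =
        (P[Y (n + 1) | pastField W Y θ₀ n]) ω i := a1.symm
    rw [a3, a2]
  have hVint : Integrable (stepDirection G γ W Y θ₀ n i - fun ω => Y (n + 1) ω i) P :=
    hZint.sub hYii
  have hVcond : P[stepDirection G γ W Y θ₀ n i - fun ω => Y (n + 1) ω i | pastField W Y θ₀ n] =ᵐ[P]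
      fun ω => meanDirection P G γ W Y θ₀ n i ω + gradient (f i) (iterate G γ W Y θ₀ n ω i) := by
    filter_upwards [condExp_sub hZint hYii (pastField W Y θ₀ n), hYcond] with ω a1 a2
    rw [a1, Pi.sub_apply, a2, sub_neg_eq_add, meanDirection]
  have hθm : StronglyMeasurable[pastField W Y θ₀ n] fun ω => iterate G γ W Y θ₀ n ω i :=
    ((by fun_prop : Measurable fun x : NetVec N d => x i).comp
      (measurable_iterate hne hcl hconv n)).stronglyMeasurable
  have hfix : ∀ y ∈ G, ∀ᵐ ω ∂P, inner ℝ (meanDirection P G γ W Y θ₀ n i ω +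
      gradient (f i) (iterate G γ W Y θ₀ n ω i)) (iterate G γ W Y θ₀ n ω i - y) ≤
        2 * γ (n + 1) * K := by
    intro y hy
    have hsub : StronglyMeasurable[pastField W Y θ₀ n] fun ω => iterate G γ W Y θ₀ n ω i - y :=
      hθm.sub stronglyMeasurable_const
    have hint : Integrable (fun ω => inner ℝ
        ((stepDirection G γ W Y θ₀ n i - fun ω => Y (n + 1) ω i) ω)
        (iterate G γ W Y θ₀ n ω i - y)) P := by
      refine (hVint.norm.mul_const (2 * R)).mono'
        (hVint.aestronglyMeasurable.inner (hsub.mono (hm.pastField_le n)).aestronglyMeasurable) ?_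
      filter_upwards [hm.iterate_mem hne hcl hconv n hn] with ω hω
      refine (norm_inner_le_norm _ _).trans (mul_le_mul_of_nonneg_left ?_ (norm_nonneg _))
      have h1 := hR _ (hω i)
      have h2 := hR _ hy
      exact (norm_sub_le _ _).trans (by linarith)
    have hpull := condExp_bilin_of_stronglyMeasurable_right
      (innerSL ℝ : Vec d →L[ℝ] Vec d →L[ℝ] ℝ) hsub hint hVint
    have hmono := condExp_mono (m := pastField W Y θ₀ n) hint (hYint.const_mul (2 * γ (n + 1))) (by
      filter_upwards [hm.iterate_mem hne hcl hconv n hn] with ω hω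
      refine (inner_localDirection_sub_le hne hcl hconv hγ (hω i) hy).trans ?_
      have h1 := PiLp.norm_apply_le (Y (n + 1) ω) i
      gcongr)
    have hmul := condExp_smul (μ := P) (2 * γ (n + 1)) (fun ω => ‖Y (n + 1) ω‖ ^ 2)
      (pastField W Y θ₀ n)
    filter_upwards [hpull, hmono, hmul, hVcond, hK] with ω a1 a2 a3 a4 a5
    rw [← a4]
    refine (a1.symm.le.trans a2).trans (a3.le.trans ?_)
    rw [Pi.smul_apply, smul_eq_mul]
    gcongr
  have : Nonempty G := hne.to_subtype
  -- The null set depends on `y`; a countable dense subset of `G` and continuity give one null set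
  -- for all `y`.
  have hdense := ae_all_iff.mpr fun k => hfix _ (TopologicalSpace.denseSeq G k).2
  filter_upwards [hdense] with ω hω y hy
  have hcont : Continuous fun y : G => inner ℝ (meanDirection P G γ W Y θ₀ n i ω +
      gradient (f i) (iterate G γ W Y θ₀ n ω i)) (iterate G γ W Y θ₀ n ω i - (y : Vec d)) := by
    fun_prop
  exact (TopologicalSpace.denseRange_denseSeq G).induction_on
    (p := fun y : G => inner ℝ (meanDirection P G γ W Y θ₀ n i ω +
      gradient (f i) (iterate G γ W Y θ₀ n ω i)) (iterate G γ W Y θ₀ n ω i - (y : Vec d)) ≤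
        2 * γ (n + 1) * K) ⟨y, hy⟩ (isClosed_le hcont continuous_const) hω

lemma ModelAssumption.integrable_netAvg [IsProbabilityMeasure P]
    (hm : ModelAssumption P G f γ W Y θ₀ μ) (hN : 1 ≤ N) (hG : IsCompact G)
    (hne : G.Nonempty) (hconv : Convex ℝ G) {n : ℕ} (hn : 1 ≤ n) :
    Integrable (fun ω => netAvg (iterate G γ W Y θ₀ n ω)) P := by
  obtain ⟨R, hR⟩ := hG.isBounded.exists_norm_le
  have hφ : Measurable (netAvg : NetVec N d → Vec d) := by unfold netAvg; fun_prop
  have hθ : Measurable (iterate G γ W Y θ₀ n) :=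
    (measurable_iterate hne hG.isClosed hconv n).mono (hm.pastField_le n) le_rfl
  refine Integrable.of_bound (hφ.comp hθ).aestronglyMeasurable R ?_
  filter_upwards [hm.iterate_mem hne hG.isClosed hconv n hn] with ω hω
  exact hR _ (netAvg_mem hN hconv hω)

/-- The noise is the gossip error of the average plus the centred local displacement, each with zero
conditional mean. -/
lemma ModelAssumption.condExp_averageNoise [IsProbabilityMeasure P]
    (hm : ModelAssumption P G f γ W Y θ₀ μ) (hN : 1 ≤ N) (hG : IsCompact G)
    (hne : G.Nonempty) (hconv : Convex ℝ G) {n : ℕ} (hn : 1 ≤ n)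
    (hγ : 0 < γ (n + 1)) (hYint : Integrable (fun ω => ‖Y (n + 1) ω‖ ^ 2) P) :
    P[averageNoise P G γ W Y θ₀ n | pastField W Y θ₀ n] =ᵐ[P] 0 := by
  have hcl := hG.isClosed
  set A : Ω → Vec d := fun ω =>
    netAvg (iterate G γ W Y θ₀ (n + 1) ω) - netAvg (tentative G γ W Y θ₀ n ω) with hA
  set a : ℝ := γ (n + 1) * (1 / (N : ℝ)) with ha
  have hZint := hm.integrable_stepDirection hne hcl hconv hn hγ hYint
  set Z : Ω → Vec d := a • ∑ i, stepDirection G γ W Y θ₀ n i with hZ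
  set H : Ω → Vec d := a • ∑ i, meanDirection P G γ W Y θ₀ n i with hH
  have hZi : Integrable Z P := (integrable_finsetSum' _ fun i _ => hZint i).smul a
  have hHi : Integrable H P := (integrable_finsetSum' _ fun i _ => integrable_condExp).smul a
  have hTm : Measurable (tentative G γ W Y θ₀ n) :=
    (measurable_tentative hne hcl hconv n).mono (hm.midField_le n) le_rfl
  have hAi : Integrable A P := by
    obtain ⟨R, hR⟩ := hG.isBounded.exists_norm_le
    have hφ : Measurable (netAvg : NetVec N d → Vec d) := by unfold netAvg; fun_prop
    refine (hm.integrable_netAvg hN hG hne hconv (by omega)).sub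
      (Integrable.of_bound (hφ.comp hTm).aestronglyMeasurable R (Eventually.of_forall fun ω => ?_))
    exact hR _ (netAvg_mem hN hconv fun j => localStep_mem hne hcl _ _ _ j)
  have hsplit : averageNoise P G γ W Y θ₀ n = A + (Z - H) := by
    funext ω
    have e1 : ∀ i, tentative G γ W Y θ₀ n ω i - iterate G γ W Y θ₀ n ω i =
        γ (n + 1) • stepDirection G γ W Y θ₀ n i ω := fun i => by
      rw [stepDirection, localDirection, smul_smul, mul_one_div_cancel hγ.ne', one_smul]; rfl
    have e2 : netAvg (tentative G γ W Y θ₀ n ω) - netAvg (iterate G γ W Y θ₀ n ω) = Z ω := by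
      rw [netAvg, netAvg, ← smul_sub, ← Finset.sum_sub_distrib]
      simp_rw [e1, ← Finset.smul_sum]
      rw [smul_smul, mul_comm, hZ, Pi.smul_apply, Finset.sum_apply]
    have e3 : γ (n + 1) • (1 / (N : ℝ)) • ∑ i, meanDirection P G γ W Y θ₀ n i ω = H ω := by
      rw [smul_smul, hH, Pi.smul_apply, Finset.sum_apply]
    rw [averageNoise, e3, Pi.add_apply, Pi.sub_apply, ← e2]
    simp only [hA]; abel
  have hZc : P[Z | pastField W Y θ₀ n] =ᵐ[P] H := by
    refine (condExp_smul a _ _).trans ?_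
    filter_upwards [condExp_finsetSum (fun i _ => hZint i) (pastField W Y θ₀ n)] with ω h1
    rw [Pi.smul_apply, h1, hH]
    rfl
  have hHm : StronglyMeasurable[pastField W Y θ₀ n] H :=
    (Finset.stronglyMeasurable_sum _ fun i _ => stronglyMeasurable_condExp).const_smul a
  have hHc : P[H | pastField W Y θ₀ n] = H :=
    condExp_of_stronglyMeasurable (hm.pastField_le n) hHm hHi
  rw [hsplit]
  filter_upwards [condExp_add hAi (hZi.sub hHi) (pastField W Y θ₀ n),
    condExp_sub hZi hHi (pastField W Y θ₀ n), hZc,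
    hm.condExp_netAvg_gossip hG hne hconv n hn] with ω h1 h2 h3 h4
  rw [h1, Pi.add_apply, h2, Pi.sub_apply, h3, hHc, h4]
  simp

lemma ModelAssumption.norm_averageNoise_sq_le
    (hm : ModelAssumption P G f γ W Y θ₀ μ) (hN : 1 ≤ N)
    (hne : G.Nonempty) (hcl : IsClosed G) (hconv : Convex ℝ G) {n : ℕ} (hn : 1 ≤ n)
    (hγ : 0 ≤ γ (n + 1)) {M : ℝ}
    (hM : ∀ᵐ ω ∂P, ∀ i, ‖meanDirection P G γ W Y θ₀ n i ω‖ ≤ M) :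
    ∀ᵐ ω ∂P, ‖averageNoise P G γ W Y θ₀ n ω‖ ^ 2 ≤ 4 * disagr (iterate G γ W Y θ₀ n ω) +
      (4 * (γ (n + 1) ^ 2 * ‖Y (n + 1) ω‖ ^ 2) + 2 * M ^ 2 * γ (n + 1) ^ 2) := by
  have hN0 : (0 : ℝ) < N := by positivity
  filter_upwards [hm.iterate_mem hne hcl hconv n hn, hm.nonneg (n + 1) (by omega),
    hm.row_stochastic (n + 1) (by omega), hM] with ω hω hw0 hw1 hMω
  set θ := iterate G γ W Y θ₀ n ω with hθ
  set T := tentative G γ W Y θ₀ n ω with hT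
  set c := netAvg θ
  set s := ∑ j, ‖T j - c‖ ^ 2 with hs
  have hs0 : 0 ≤ s := Finset.sum_nonneg fun j _ => sq_nonneg _
  have hball : ∀ j, T j ∈ Metric.closedBall c (Real.sqrt s) := fun j => by
    rw [mem_closedBall_iff_norm]
    exact Real.le_sqrt_of_sq_le (Finset.single_le_sum (f := fun j => ‖T j - c‖ ^ 2)
      (fun j _ => sq_nonneg _) (Finset.mem_univ j))
  -- Rows of `W` are convex weights, so gossip cannot leave a ball containing all tentative states,
  -- even though it may move the average.
  have hnext : netAvg (iterate G γ W Y θ₀ (n + 1) ω) ∈ Metric.closedBall c (Real.sqrt s) :=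
    netAvg_mem hN (convex_closedBall _ _) fun i => (convex_closedBall c (Real.sqrt s)).sum_mem
      (fun j _ => hw0 i j) (hw1 i) fun j _ => hball j
  rw [mem_closedBall_iff_norm] at hnext
  have h1 : ‖netAvg (iterate G γ W Y θ₀ (n + 1) ω) - c‖ ^ 2 ≤ s := by
    have := pow_le_pow_left₀ (norm_nonneg _) hnext 2
    rwa [Real.sq_sqrt hs0] at this
  have h2 : s ≤ 2 * disagr θ + 2 * (γ (n + 1) ^ 2 * ‖Y (n + 1) ω‖ ^ 2) := by
    rw [hs, disagr, PiLp.norm_sq_eq_of_L2, Finset.mul_sum, Finset.mul_sum, Finset.mul_sum,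
      ← Finset.sum_add_distrib]
    refine Finset.sum_le_sum fun j _ => ?_
    have a1 : ‖T j - θ j‖ ≤ γ (n + 1) * ‖Y (n + 1) ω j‖ :=
      norm_localStep_sub_le hne hcl hconv hγ (hω j)
    have a2 : ‖T j - c‖ ≤ ‖θ j - c‖ + γ (n + 1) * ‖Y (n + 1) ω j‖ := by
      have e : T j - c = (θ j - c) + (T j - θ j) := by abel
      rw [e]; exact (norm_add_le _ _).trans (by linarith)
    have a3 := pow_le_pow_left₀ (norm_nonneg _) a2 2
    have a4 := sq_nonneg (‖θ j - c‖ - γ (n + 1) * ‖Y (n + 1) ω j‖)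
    rw [← mul_pow]
    nlinarith
  have h3 : ‖γ (n + 1) • (1 / (N : ℝ)) • ∑ i, meanDirection P G γ W Y θ₀ n i ω‖ ≤ γ (n + 1) * M := by
    rw [norm_smul, Real.norm_of_nonneg hγ, norm_smul, Real.norm_of_nonneg (by positivity)]
    refine mul_le_mul_of_nonneg_left ?_ hγ
    rw [one_div_mul_eq_div, div_le_iff₀ hN0]
    refine (norm_sum_le_of_le _ fun i _ => hMω i).trans ?_
    simp [mul_comm]
  have h4 := pow_le_pow_left₀ (norm_nonneg _) h3 2
  have h5 := norm_sub_le (netAvg (iterate G γ W Y θ₀ (n + 1) ω) - c)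
    (γ (n + 1) • (1 / (N : ℝ)) • ∑ i, meanDirection P G γ W Y θ₀ n i ω)
  have h6 := pow_le_pow_left₀ (norm_nonneg _) h5 2
  have h7 := sq_nonneg (‖netAvg (iterate G γ W Y θ₀ (n + 1) ω) - c‖ -
    ‖γ (n + 1) • (1 / (N : ℝ)) • ∑ i, meanDirection P G γ W Y θ₀ n i ω‖)
  rw [averageNoise]
  nlinarith

end MeanField

/-! ### Assembly of the almost sure statement. -/

section Convergence

variable {Ω : Type*} {N d : ℕ} {G : Set (Vec d)} {γ : ℕ → ℝ}
  {W : ℕ → Ω → Matrix (Fin N) (Fin N) ℝ} {Y : ℕ → Ω → NetVec N d} {θ₀ : Ω → NetVec N d}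
  [mΩ : MeasurableSpace Ω] {P : Measure Ω} {f : Fin N → Vec d → ℝ}
  {μ : NetVec N d → Measure (NetVec N d)}

lemma StepAssumption.sum_shift {ρ : ℕ → ℝ} (h : StepAssumption γ ρ) :
    Tendsto (fun n => ∑ k ∈ Finset.range n, γ (k + 2)) atTop atTop := by
  have h1 := (tendsto_add_atTop_iff_nat 1).mpr h.sum_infinite
  refine (tendsto_atTop_add_const_right atTop (-γ 1) h1).congr fun n => ?_
  induction n with
  | zero => simp
  | succ n ih =>
    rw [Finset.sum_Icc_succ_top (by omega), Finset.sum_range_succ, ← ih]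
    ring

lemma stronglyMeasurable_averageNoise
    (hne : G.Nonempty) (hcl : IsClosed G) (hconv : Convex ℝ G) (n : ℕ) :
    StronglyMeasurable[pastField W Y θ₀ (n + 1)] (averageNoise P G γ W Y θ₀ n) := by
  have hle : pastField W Y θ₀ n ≤ pastField W Y θ₀ (n + 1) := pastField_mono (by omega)
  have hφ : Measurable (netAvg : NetVec N d → Vec d) := by unfold netAvg; fun_prop
  have h1 : Measurable[pastField W Y θ₀ (n + 1)] fun ω =>
      netAvg (iterate G γ W Y θ₀ (n + 1) ω) := hφ.comp (measurable_iterate hne hcl hconv (n + 1))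
  have h2 : Measurable[pastField W Y θ₀ (n + 1)] fun ω => netAvg (iterate G γ W Y θ₀ n ω) :=
    hφ.comp ((measurable_iterate hne hcl hconv n).mono hle le_rfl)
  have h3 : StronglyMeasurable[pastField W Y θ₀ (n + 1)] fun ω =>
      ∑ i, meanDirection P G γ W Y θ₀ n i ω :=
    Finset.stronglyMeasurable_fun_sum _ fun i _ => stronglyMeasurable_condExp.mono hle
  exact (h1.stronglyMeasurable.sub h2.stronglyMeasurable).sub ((h3.fun_const_smul _).fun_const_smul _)

/-- Almost sure convergence for a general convex compact constraint set. -/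
theorem ae_convergence [IsProbabilityMeasure P] (hN : 1 ≤ N) (hG : IsCompact G)
    (hne : G.Nonempty) (hconv : Convex ℝ G) (hm : ModelAssumption P G f γ W Y θ₀ μ)
    (hstep : StepAssumption γ (fun n => rho P (W n)))
    (hint : interior (avgUtility f '' kktSet G (avgUtility f)) = ∅) :
    ∀ᵐ ω ∂P, ConvergesToSet (fun n => iterate G γ W Y θ₀ n ω)
        (consensus N '' kktSet G (avgUtility f)) ∧
      ∃ a ∈ kktSet G (avgUtility f),
        ConvergesToSet (fun n => netAvg (iterate G γ W Y θ₀ n ω))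
          (connectedComponentIn (kktSet G (avgUtility f)) a) := by
  have hcl := hG.isClosed
  obtain ⟨K, hK0, hK⟩ := hm.exists_moment_bound hne hcl hconv
  have hpos : ∀ n, 0 < γ (n + 1) := fun n => hstep.pos _ (by omega)
  have hYK : ∀ n, 1 ≤ n → ∫ ω, ‖Y (n + 1) ω‖ ^ 2 ∂P ≤ K := fun n hn => by
    rw [← integral_condExp (hm.pastField_le n)]
    exact (integral_mono_ae integrable_condExp (integrable_const K) (hK n hn).2).trans (by simp)
  have hU : Summable fun n => ∫ ω, disagr (iterate G γ W Y θ₀ n ω) ∂P :=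
    hstep.summable_disagreement (fun n => norm_nonneg _) hm.connectivity
      (fun n => integral_nonneg fun ω => disagr_nonneg _) hK0
      (fun n hn η hη => hm.disagr_recursion hN hG hne hconv hn (hpos n).le (hK n hn).1 (hK n hn).2 hη)
  have hdis : ∀ᵐ ω ∂P, Tendsto (fun n => disagr (iterate G γ W Y θ₀ (n + 1) ω)) atTop (𝓝 0) :=
    ae_tendsto_zero_of_summable_integral
      (fun n => hm.integrable_disagr hN hG hne hconv (n + 1) (by omega))
      (fun n => Eventually.of_forall fun ω => disagr_nonneg _)
      ((summable_nat_add_iff 1).mpr hU)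
  have hM : ∀ n, ∀ᵐ ω ∂P, ∀ i, ‖meanDirection P G γ W Y θ₀ (n + 1) i ω‖ ≤ 1 + K := fun n =>
    hm.norm_meanDirection_le hne hcl hconv (by omega) (hpos _) (hK (n + 1) (by omega)).1
      (hK (n + 1) (by omega)).2
  have hnoise : ∀ᵐ ω ∂P, ∃ c, Tendsto (fun n => ∑ k ∈ Finset.range n,
      averageNoise P G γ W Y θ₀ (k + 1) ω) atTop (𝓝 c) := by
    -- The filtration is shifted by one because the conditional hypotheses start at `n = 1`.
    let ℱ : Filtration ℕ mΩ :=
      ⟨fun n => pastField W Y θ₀ (n + 1), fun a b hab => pastField_mono (by omega),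
        fun n => hm.pastField_le _⟩
    set B : ℕ → Ω → ℝ := fun n ω => 4 * disagr (iterate G γ W Y θ₀ (n + 1) ω) +
      (4 * (γ (n + 2) ^ 2 * ‖Y (n + 2) ω‖ ^ 2) + 2 * (1 + K) ^ 2 * γ (n + 2) ^ 2) with hB
    have hle : ∀ n, ∀ᵐ ω ∂P, ‖averageNoise P G γ W Y θ₀ (n + 1) ω‖ ^ 2 ≤ B n ω := fun n =>
      hm.norm_averageNoise_sq_le hN hne hcl hconv (by omega) (hpos _).le (hM n)
    have hdi : ∀ n, Integrable (fun ω => 4 * disagr (iterate G γ W Y θ₀ (n + 1) ω)) P := fun n =>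
      (hm.integrable_disagr hN hG hne hconv (n + 1) (by omega)).const_mul 4
    have hYi : ∀ n, Integrable (fun ω => 4 * (γ (n + 2) ^ 2 * ‖Y (n + 2) ω‖ ^ 2)) P := fun n =>
      ((hK (n + 1) (by omega)).1.const_mul _).const_mul 4
    have hrest : ∀ n, Integrable (fun ω => 4 * (γ (n + 2) ^ 2 * ‖Y (n + 2) ω‖ ^ 2) +
        2 * (1 + K) ^ 2 * γ (n + 2) ^ 2) P := fun n => (hYi n).add (integrable_const _)
    have hBi : ∀ n, Integrable (B n) P := fun n => (hdi n).add (hrest n)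
    have hBint : ∀ n, ∫ ω, B n ω ∂P ≤ 4 * ∫ ω, disagr (iterate G γ W Y θ₀ (n + 1) ω) ∂P +
        (4 * K + 2 * (1 + K) ^ 2) * γ (n + 2) ^ 2 := fun n => by
      rw [hB]
      simp only
      rw [integral_add (hdi n) (hrest n), integral_add (hYi n) (integrable_const _),
        integral_const_mul, integral_const_mul, integral_const_mul]
      have h1 := mul_le_mul_of_nonneg_left (hYK (n + 1) (by omega)) (sq_nonneg (γ (n + 2)))
      simp only [integral_const, probReal_univ, smul_eq_mul, one_mul]
      linarith
    have hsm : ∀ n, StronglyMeasurable[pastField W Y θ₀ (n + 2)]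
        (averageNoise P G γ W Y θ₀ (n + 1)) := fun n =>
      stronglyMeasurable_averageNoise hne hcl hconv (n + 1)
    have hL2 : ∀ n, Integrable (fun ω => ‖averageNoise P G γ W Y θ₀ (n + 1) ω‖ ^ 2) P := fun n => by
      refine (hBi n).mono' (((hsm n).mono (hm.pastField_le _)).norm.pow 2).aestronglyMeasurable ?_
      filter_upwards [hle n] with ω hω
      rwa [Real.norm_of_nonneg (by positivity)]
    refine ae_exists_tendsto_sum (ℱ := ℱ) hsm hL2 (fun n =>
      hm.condExp_averageNoise hN hG hne hconv (by omega) (hpos _) (hK (n + 1) (by omega)).1) ?_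
    refine Summable.of_nonneg_of_le (fun n => integral_nonneg fun ω => by positivity)
      (fun n => (integral_mono_ae (hL2 n) (hBi n) (hle n)).trans (hBint n)) ?_
    exact (((summable_nat_add_iff 1).mpr hU).mul_left 4).add
      (((summable_nat_add_iff 2).mpr hstep.summable_sq).mul_left _)
  have hmem : ∀ᵐ ω ∂P, ∀ n i, iterate G γ W Y θ₀ (n + 1) ω i ∈ G :=
    ae_all_iff.mpr fun n => hm.iterate_mem hne hcl hconv (n + 1) (by omega)
  have hvar := ae_all_iff.mpr fun n => hm.meanDirection_variational hG hne hconv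
    (by omega : 1 ≤ n + 1) (hpos _) (hK (n + 1) (by omega)).1 (hK (n + 1) (by omega)).2
  filter_upwards [hdis, ae_all_iff.mpr hM, hnoise, hmem, hvar] with ω h1 h2 h3 h4 h5
  -- The trajectory starts at `θ_1`, the first state known to lie in `G^N`; its first step then uses
  -- `γ 2`.
  obtain ⟨c1, a, ha, c2⟩ := pathwise_convergence hN hG hconv hne hm.contDiff
    (θ := fun n => iterate G γ W Y θ₀ (n + 1) ω)
    (H := fun n i => meanDirection P G γ W Y θ₀ (n + 1) i ω) (γ := fun n => γ (n + 2)) (K := K)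
    (M := 1 + K) h4 h1 (fun n => hpos _) ((tendsto_add_atTop_iff_nat 2).mpr hstep.tendsto_zero)
    hstep.sum_shift (by positivity) h2 h5 h3 hint
  exact ⟨(tendsto_add_atTop_iff_nat 1).mp c1, a, ha, (tendsto_add_atTop_iff_nat 1).mp c2⟩

end Convergence

lemma ConstraintAssumption.convex_feasibleSet {d p : ℕ} {q : Fin p → Vec d → ℝ}
    (h : ConstraintAssumption q) : Convex ℝ (feasibleSet q) := by
  have e : feasibleSet q = ⋂ j, {x | x ∈ Set.univ ∧ q j x ≤ 0} := by
    ext x; simp [feasibleSet]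
  rw [e]
  exact convex_iInter fun j => (h.convex j).convex_le 0

end DistGossip

end

theorem theorem1 {Ω : Type*} [MeasurableSpace Ω] (P : Measure Ω) [IsProbabilityMeasure P]
    {N d p : ℕ} (hN : 1 ≤ N)
    (q : Fin p → DistGossip.Vec d → ℝ) (f : Fin N → DistGossip.Vec d → ℝ) (γ : ℕ → ℝ)
    (W : ℕ → Ω → Matrix (Fin N) (Fin N) ℝ) (Y : ℕ → Ω → DistGossip.NetVec N d)
    (θ₀ : Ω → DistGossip.NetVec N d)
    (μ : DistGossip.NetVec N d → Measure (DistGossip.NetVec N d))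
    (hmodel : DistGossip.ModelAssumption P (DistGossip.feasibleSet q) f γ W Y θ₀ μ)
    (hstep : DistGossip.StepAssumption γ (fun n => DistGossip.rho P (W n)))
    (hconstr : DistGossip.ConstraintAssumption q)
    (hint : interior (DistGossip.avgUtility f ''
      DistGossip.kktSet (DistGossip.feasibleSet q) (DistGossip.avgUtility f)) = ∅) :
    (∀ᵐ ω ∂P, DistGossip.ConvergesToSet
      (fun n => DistGossip.iterate (DistGossip.feasibleSet q) γ W Y θ₀ n ω)
      (DistGossip.consensus N ''
        DistGossip.kktSet (DistGossip.feasibleSet q) (DistGossip.avgUtility f))) ∧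
    (∀ᵐ ω ∂P,
      ∃ θ ∈ DistGossip.kktSet (DistGossip.feasibleSet q) (DistGossip.avgUtility f),
        DistGossip.ConvergesToSet
          (fun n => DistGossip.netAvg
            (DistGossip.iterate (DistGossip.feasibleSet q) γ W Y θ₀ n ω))
          (connectedComponentIn
            (DistGossip.kktSet (DistGossip.feasibleSet q) (DistGossip.avgUtility f)) θ)) := by
  have h := DistGossip.ae_convergence hN hconstr.compact hconstr.nonempty
    hconstr.convex_feasibleSet hmodel hstep hint
  exact ⟨h.mono fun _ hω => hω.1, h.mono fun _ hω => hω.2⟩
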